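/- Let $n\ge 1$, $\beta>0$, and let $V(x)=\widetilde V(|x|)$ be a radial potential on $\mathbb R^n$ of class $C^2$. Put $\mu_n(dx)=e^{-\beta V(x)}\,dx$, $\Phi_n(x)=|x|$, $\nu_n=(\Phi_n)_\#\mu_n$, and $S_n(y)=(n-1)\log y$ for $y>0$. Consider the diffusion $dX_t=-\nabla V(X_t)\,dt+\sqrt{2/\beta}\,dW_t$, where $W$ is an $n$-dimensional Brownian motion and $X_0$ is independent of $W$, and let $Y_t=|X_t|$. (1) If for every starting point the equation for $X$ has a solution defined for all times, then $Y$ has transition kernels $\kappa_t$ (that is, $\mathrm{law}(Y_t)=\mathrm{law}(Y_0)\,\kappa_t$ for every initial law of $X$), and $\nu_n$ is invariant: $\nu_n\kappa_t=\nu_n$ for all $t\ge 0$. If $\int_{\mathbb R^n} e^{-\beta V}\,dx<\infty$, then (without that assumption) every global solution $X$ such that $Y_0$ has as its law the probability measure $\bar\nu_n=\nu_n/\nu_n(\mathbb R)$ satisfies $\mathrm{law}(Y_t)=\bar\nu_n$ for all $t\ge0$. (2) There is a function $F_n$ (the free energy) such that $$\nu_n(dy)=c_n'\,e^{-\beta F_n(y)}\,dy\quad\text{on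 }(0,\infty),\qquad c'_n>0;$$ if $\int_{\mathbb R^n} e^{-\beta V}\,dx<\infty$, also $\bar\nu_n(dy)=\big(\int_0^\infty e^{-\beta F_n(r)}\,dr\big)^{-1}e^{-\beta F_n(y)}\,dy$. Any measurable $G$ with $\nu_n(dy)=c\,e^{-\beta G(y)}\,dy$ on $(0,\infty)$ for some $c>0$ equals $F_n$ up to an additive constant, almost everywhere. Moreover $$-\beta F_n(y)=\log\frac{d(\Phi_n)_\#\mu_n}{d\mathscr L^1}(y)+\mathrm{constant}_{1,n}\quad\text{for a.e. }y>0,$$ $$-\beta F_n(y)=\log\int_{\mathbb R^n}e^{-\beta V(x)}\,\delta[\Phi_n(x)-y](dx)+\mathrm{constant}_{2,n},$$ with finite positive density and integral, and $$F_n(y)=\widetilde V(y)-\frac1\beta S_n(y)\quad\text{for all }y>0.$$ The constants $c_n'$, $\mathrm{constant}_{1,n}$, $\mathrm{constant}_{2,n}$ depend only on $n$. Here the microcanonical measures $\delta[f(x)-a](dx)$ are locally finite measures on $\mathbb R^n$ with $$\int_{\mathbb R}G(a)\int_{\mathbb R^n}F(x)\,\delta[f(x)-a](dx)\,da=\int_{\mathbb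 R^n}G(f(x))F(x)\,dx\qquad(F\in C_c(\mathbb R^n),\ G\in C(\mathbb R)),$$ which determines them for a.e. $a$, or, at a single level $a$, $$\int\varphi(x)\,\delta[f(x)-a](dx)=\lim_{h\downarrow0}\frac1h\int_{\mathbb R^n}\varphi(x)\,\mathbf 1\{a\le f(x)<a+h\}\,dx\qquad(\varphi\in C_c(\mathbb R^n)).$$ For $f=\Phi_n$ there is a family satisfying the first identity and, at every level $a>0$, the second. The microcanonical formula for $F_n$ holds for a.e. $y>0$ for every family as in the first definition, and for every $y>0$ with the second. -/

import Mathlib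

open MeasureTheory ProbabilityTheory Set Filter Topology
open scoped NNReal ENNReal Gradient

universe u

noncomputable section

/-- `W` is a standard `n`-dimensional Brownian motion under `P`: its coordinates are independent
one-dimensional Brownian motions. -/
structure IsBrownianVec {n : ℕ} {Ω : Type u} [MeasurableSpace Ω] (P : Measure Ω)
    (W : ℝ≥0 → Ω → EuclideanSpace ℝ (Fin n)) : Prop where
  measurable : ∀ t, Measurable (W t)
  isBrownian : ∀ i, IsBrownianReal (fun t ω => W t ω i) P
  indep : iIndepFun (fun i ω (t : ℝ≥0) => W t ω i) P

/-- `X` is a (global in time) solution of `dX = -∇V(X) dt + √(2/β) dW` on the probability space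
`(Ω, P)`. Since the noise is additive, the integrated equation contains no stochastic integral:
`X_t = X_0 - ∫₀ᵗ ∇V(X_s) ds + √(2/β) W_t`. The initial datum is independent of the noise. -/
structure IsLangevinSolution {n : ℕ} (β : ℝ) (V : EuclideanSpace ℝ (Fin n) → ℝ)
    {Ω : Type u} [MeasurableSpace Ω] (P : Measure Ω)
    (W X : ℝ≥0 → Ω → EuclideanSpace ℝ (Fin n)) : Prop where
  isProbabilityMeasure : IsProbabilityMeasure P
  isBrownianVec : IsBrownianVec P W
  measurable : ∀ t, Measurable (X t)
  indep_initial : IndepFun (X 0) (fun ω (t : ℝ≥0) => W t ω) P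
  continuous_paths : ∀ᵐ ω ∂P, Continuous (fun t => X t ω)
  equation : ∀ᵐ ω ∂P, ∀ t : ℝ≥0,
    X t ω = X 0 ω - (∫ s in (0 : ℝ)..t, ∇ V (X s.toNNReal ω)) + √(2 / β) • W t ω

/-- From every deterministic starting point the equation has a solution that is defined for all
times, i.e. the diffusion does not explode. -/
def LangevinWellPosed {n : ℕ} (β : ℝ) (V : EuclideanSpace ℝ (Fin n) → ℝ) : Prop :=
  ∀ x : EuclideanSpace ℝ (Fin n), ∃ (Ω : Type u) (_ : MeasurableSpace Ω) (P : Measure Ω)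
    (W X : ℝ≥0 → Ω → EuclideanSpace ℝ (Fin n)),
    IsLangevinSolution β V P W X ∧ ∀ᵐ ω ∂P, X 0 ω = x

/-- `κ` is the family of transition kernels of the process `Y = |X|`: whatever the initial law of
`X` (in particular for deterministic `X_0`), the law of `Y_t` is the law of `Y_0` transported by
`κ t`. -/
def IsRadialTransition {n : ℕ} (β : ℝ) (V : EuclideanSpace ℝ (Fin n) → ℝ)
    (κ : ℝ≥0 → Kernel ℝ ℝ) : Prop :=
  (∀ t, IsMarkovKernel (κ t)) ∧
  ∀ (Ω : Type u) [MeasurableSpace Ω] (P : Measure Ω)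
    (W X : ℝ≥0 → Ω → EuclideanSpace ℝ (Fin n)), IsLangevinSolution β V P W X →
    ∀ t, P.map (fun ω => ‖X t ω‖) = (P.map (fun ω => ‖X 0 ω‖)).bind (κ t)

/-- The measure `μ_n(dx) = e^{-βV(x)} dx` on `ℝⁿ`. -/
def gibbsMeasure {n : ℕ} (β : ℝ) (V : EuclideanSpace ℝ (Fin n) → ℝ) :
    Measure (EuclideanSpace ℝ (Fin n)) :=
  volume.withDensity (fun x => ENNReal.ofReal (Real.exp (-β * V x)))

/-- The coarse-grained measure `ν_n`: the push-forward of `μ_n` under `Φ_n(x) = |x|`. -/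
def radialMeasure {n : ℕ} (β : ℝ) (V : EuclideanSpace ℝ (Fin n) → ℝ) : Measure ℝ :=
  (gibbsMeasure β V).map (fun x => ‖x‖)

/-- The entropy `S_n(y) = (n - 1) log y`. -/
def radialEntropy (n : ℕ) (y : ℝ) : ℝ := ((n : ℝ) - 1) * Real.log y

/-- The family `δ a` consists of the microcanonical measures `δ[f(x) - a](dx)`: it disintegrates
Lebesgue measure along the level sets of `f`, i.e.
`∫ G(a) ∫ F(x) δ[f(x) - a](dx) da = ∫ G(f(x)) F(x) dx` for `F ∈ C_c(ℝⁿ)` and `G ∈ C(ℝ)`. -/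
def IsMicrocanonicalFamily {n : ℕ} (f : EuclideanSpace ℝ (Fin n) → ℝ)
    (δ : ℝ → Measure (EuclideanSpace ℝ (Fin n))) : Prop :=
  (∀ᵐ a, IsLocallyFiniteMeasure (δ a)) ∧
  ∀ F : EuclideanSpace ℝ (Fin n) → ℝ, Continuous F → HasCompactSupport F →
    ∀ G : ℝ → ℝ, Continuous G →
      Integrable (fun a => G a * ∫ x, F x ∂(δ a)) ∧
      ∫ a, G a * ∫ x, F x ∂(δ a) = ∫ x, G (f x) * F x

/-- `m` is the microcanonical measure `δ[f(x) - a](dx)` at the single level `a`, in the sense of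
thin shells: `∫ φ dm = lim_{h ↓ 0} h⁻¹ ∫ φ(x) 1{a ≤ f(x) < a + h} dx` for `φ ∈ C_c(ℝⁿ)`. -/
def IsMicrocanonicalAt {n : ℕ} (f : EuclideanSpace ℝ (Fin n) → ℝ) (a : ℝ)
    (m : Measure (EuclideanSpace ℝ (Fin n))) : Prop :=
  IsLocallyFiniteMeasure m ∧
  ∀ φ : EuclideanSpace ℝ (Fin n) → ℝ, Continuous φ → HasCompactSupport φ →
    Tendsto (fun h : ℝ => h⁻¹ * ∫ x in {x | a ≤ f x ∧ f x < a + h}, φ x) (𝓝[>] 0)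
      (𝓝 (∫ x, φ x ∂m))

end

/-!
The heart of the proof is that the Langevin diffusion is reversible for the Gibbs measure
`e^{-βV} dx`. This is shown without generators, semigroups or stochastic integrals, by means of the
Euler scheme with `N` steps of size `h = T / N`.

* The noise is additive, so the Euler chain driven by the increments of the Brownian motion
  converges to the given solution path by path, by a discrete Gronwall argument on the compact range
  of the path (`eulerPath_tendsto`). No growth condition on `∇V` is needed, only that this one path
  exists up to time `T`.
* The Euler path started from the Gibbs measure has an explicit density on path space
  (`lintegral_eulerPath`). The logarithm of the ratio of this density at the reversed path and at
  the path is `pathLogRatio`: a sum of errors of the trapezoidal rule for `∫ ∇V`, plus a telescoping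
  term of order `h` (`pathDensity_rev`). Since `V` is of class `C²`, each error is
  `o(|increment|²)`, and the quadratic variation of the noise stays bounded in mean; so the
  logarithm tends to zero in probability (`tendsto_lintegral_one_sub_weight`).
* Weighting each path by `min 1 ratio` turns the Euler operator into one that is exactly symmetric
  for the Gibbs measure (`lintegral_symmetrizedEuler_comm`) and that has the same limit
  (`tendsto_lintegral_symmetrizedEuler`).

The operator commutes with rotations, so it acts on radial functions; its limit gives the
transition kernels of `|X|`, which are symmetric for the coarse-grained measure. A symmetric Markov
kernel leaves its measure invariant, of finite mass or not, by testing against functions that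
increase to `1` (`exists_isRadialTransition`). If the law of `|X_0|` is a multiple of the
coarse-grained measure, one global solution suffices (`map_norm_eq_of_initial`).

The free energy is a matter of polar coordinates. The surface measures of the spheres `|x| = y`
are the microcanonical measures (`isMicrocanonicalFamily_sphereMeasure`,
`isMicrocanonicalAt_sphereMeasure`), and they give `e^{-βV}` the mass
`|S^{n-1}| y^{n-1} e^{-βṼ(y)} = |S^{n-1}| e^{-βF(y)}`. Any other microcanonical measure integrates
test functions in the same way, at the given level or at almost every level; monotone convergence
carries this over to `e^{-βV}` (`freeEnergy_eq_log_integral`).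
-/

namespace Langevin

/-! ### Gaussian increments -/

/-- The centred Gaussian measure on `ℝⁿ` whose coordinates are independent with variance `v`. -/
noncomputable def isoGaussian (n : ℕ) (v : ℝ≥0) : Measure (EuclideanSpace ℝ (Fin n)) :=
  (Measure.pi fun _ : Fin n => gaussianReal 0 v).map (WithLp.toLp 2)

instance (n : ℕ) (v : ℝ≥0) : IsProbabilityMeasure (isoGaussian n v) :=
  Measure.isProbabilityMeasure_map (by fun_prop)

/-- The density of `isoGaussian n v` with respect to Lebesgue measure. -/
noncomputable def isoGaussianPDF (n : ℕ) (v : ℝ≥0) (z : EuclideanSpace ℝ (Fin n)) : ℝ :=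
  (√(2 * Real.pi * v))⁻¹ ^ n * Real.exp (-‖z‖ ^ 2 / (2 * v))

lemma continuous_isoGaussianPDF (n : ℕ) (v : ℝ≥0) : Continuous (isoGaussianPDF n v) := by
  unfold isoGaussianPDF; fun_prop

lemma isoGaussianPDF_pos (n : ℕ) {v : ℝ≥0} (hv : v ≠ 0) (z : EuclideanSpace ℝ (Fin n)) :
    0 < isoGaussianPDF n v z := by
  have : 0 < (v : ℝ) := by positivity
  unfold isoGaussianPDF; positivity

lemma isoGaussianPDF_eq_prod (n : ℕ) (v : ℝ≥0) (z : EuclideanSpace ℝ (Fin n)) :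
    isoGaussianPDF n v z = ∏ i, gaussianPDFReal 0 v (z i) := by
  simp only [isoGaussianPDF, gaussianPDFReal, sub_zero, Finset.prod_mul_distrib,
    Finset.prod_const, Finset.card_univ, Fintype.card_fin, ← Real.exp_sum,
    EuclideanSpace.real_norm_sq_eq]
  rw [← Finset.sum_div, Finset.sum_neg_distrib]

lemma pi_gaussianReal_eq_withDensity (n : ℕ) {v : ℝ≥0} (hv : v ≠ 0) :
    (Measure.pi fun _ : Fin n => gaussianReal 0 v) =
      volume.withDensity fun x => ENNReal.ofReal (∏ i, gaussianPDFReal 0 v (x i)) := by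
  refine Measure.pi_eq fun s hs => ?_
  have hnn : ∀ x, 0 ≤ gaussianPDFReal 0 v x := gaussianPDFReal_nonneg 0 v
  rw [withDensity_apply _ (MeasurableSet.univ_pi hs), volume_pi, Measure.restrict_pi_pi,
    ← ofReal_integral_eq_lintegral_ofReal, integral_fintype_prod_eq_prod,
    ENNReal.ofReal_prod_of_nonneg fun i _ => integral_nonneg hnn]
  · refine Finset.prod_congr rfl fun i _ => ?_
    rw [gaussianReal_apply_eq_integral _ hv]
  · exact Integrable.fintype_prod fun i => (integrable_gaussianPDFReal 0 v).restrict
  · exact ae_of_all _ fun x => Finset.prod_nonneg fun i _ => hnn _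

lemma isoGaussian_eq_withDensity (n : ℕ) {v : ℝ≥0} (hv : v ≠ 0) :
    isoGaussian n v = volume.withDensity fun z => ENNReal.ofReal (isoGaussianPDF n v z) := by
  have hm := continuous_isoGaussianPDF n v
  rw [isoGaussian, pi_gaussianReal_eq_withDensity n hv]
  ext s hs
  rw [Measure.map_apply (by fun_prop) hs, withDensity_apply _ hs,
    withDensity_apply _ (hs.preimage (by fun_prop)),
    ← (PiLp.volume_preserving_toLp (Fin n)).setLIntegral_comp_preimage hs (by fun_prop)]
  simp [isoGaussianPDF_eq_prod]

/-- A function of the norm has the same density, so the Gaussian measure is rotation invariant. -/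
lemma measurePreserving_isoGaussian (n : ℕ) {v : ℝ≥0} (hv : v ≠ 0)
    (U : EuclideanSpace ℝ (Fin n) ≃ₗᵢ[ℝ] EuclideanSpace ℝ (Fin n)) :
    MeasurePreserving U (isoGaussian n v) (isoGaussian n v) := by
  refine ⟨U.continuous.measurable, ?_⟩
  have hm := continuous_isoGaussianPDF n v
  ext s hs
  rw [Measure.map_apply U.continuous.measurable hs, isoGaussian_eq_withDensity n hv,
    withDensity_apply _ hs, withDensity_apply _ (hs.preimage U.continuous.measurable),
    ← U.measurePreserving.setLIntegral_comp_preimage hs (by fun_prop)]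
  simp [isoGaussianPDF]

/-- The second moment of a Gaussian vector. -/
lemma lintegral_norm_sq_isoGaussian (n : ℕ) (v : ℝ≥0) :
    ∫⁻ z, ENNReal.ofReal (‖z‖ ^ 2) ∂(isoGaussian n v) = n * v := by
  have h1 : ∀ i : Fin n, ∫⁻ x : Fin n → ℝ, ENNReal.ofReal (x i ^ 2)
      ∂(Measure.pi fun _ : Fin n => gaussianReal 0 v) = v := by
    intro i
    have := (measurePreserving_eval (fun _ : Fin n => gaussianReal 0 v) i).lintegral_comp
      (f := fun y : ℝ => ENNReal.ofReal (y ^ 2)) (by fun_prop)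
    simp only [Function.eval] at this
    have hint : Integrable (fun x : ℝ => x ^ 2) (gaussianReal 0 v) :=
      (memLp_id_gaussianReal 2).integrable_sq
    rw [this, ← ofReal_integral_eq_lintegral_ofReal hint (ae_of_all _ fun x => by positivity)]
    have hvar := variance_eq_sub (memLp_id_gaussianReal (μ := 0) (v := v) 2)
    simp [variance_id_gaussianReal] at hvar
    simp [← hvar]
  rw [isoGaussian, lintegral_map (by fun_prop) (by fun_prop)]
  simp only [EuclideanSpace.real_norm_sq_eq]
  have : ∀ x : Fin n → ℝ, ENNReal.ofReal (∑ i, x i ^ 2) = ∑ i, ENNReal.ofReal (x i ^ 2) :=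
    fun x => ENNReal.ofReal_sum_of_nonneg fun i _ => sq_nonneg _
  simp only [this]
  rw [lintegral_finsetSum _ (fun i _ => by fun_prop)]
  simp [h1]

section Increments

variable {n : ℕ} {Ω : Type u} [MeasurableSpace Ω] {P : Measure Ω}
  {W : ℝ≥0 → Ω → EuclideanSpace ℝ (Fin n)}

lemma map_coord_increment (hW : IsBrownianVec P W) (k : ℕ) (h : ℝ≥0) (c : ℝ) (i : Fin n) :
    P.map (fun ω => c * (W ((k + 1 : ℕ) * h) ω i - W ((k : ℕ) * h) ω i)) =
      gaussianReal 0 (.mk (c ^ 2) (sq_nonneg _) * h) := by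
  have h1 := (hW.isBrownian i).hasLaw_sub ((k + 1 : ℕ) * h) ((k : ℕ) * h)
  have h2 := (gaussianReal_const_mul h1 c).map_eq
  simp only [mul_zero] at h2
  refine h2.trans ?_
  congr 1
  apply NNReal.eq
  simp [add_mul]

lemma iIndepFun_coord_increments [IsProbabilityMeasure P] (hW : IsBrownianVec P W)
    (N : ℕ) (h : ℝ≥0) (c : ℝ) :
    iIndepFun (fun (p : Fin N × Fin n) ω =>
      c * (W ((p.1 + 1 : ℕ) * h) ω p.2 - W ((p.1 : ℕ) * h) ω p.2)) P := by
  have hWm := hW.measurable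
  let D : Fin n → Fin N → Ω → ℝ := fun i k ω => c * (W ((k + 1 : ℕ) * h) ω i - W ((k : ℕ) * h) ω i)
  have hDm : ∀ i k, Measurable (D i k) := fun i k => by
    have h1 := hWm ((k + 1 : ℕ) * h)
    have h2 := hWm ((k : ℕ) * h)
    fun_prop
  have hmono : Monotone fun k : Fin (N + 1) => ((k : ℕ) : ℝ≥0) * h := fun a b hab => by
    have : (a : ℕ) ≤ b := hab
    simp only
    gcongr
  have hin : ∀ i, iIndepFun (D i) P := fun i =>
    ((hW.isBrownian i).hasIndepIncrements N _ hmono).comp (fun _ x => c * x)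
      (fun _ => by fun_prop)
  have hout : iIndepFun (fun i ω k => D i k ω) P := by
    refine hW.indep.comp
      (fun _ (w : ℝ≥0 → ℝ) (k : Fin N) => c * (w ((k + 1 : ℕ) * h) - w ((k : ℕ) * h))) fun _ => ?_
    fun_prop
  exact (iIndepFun_uncurry' hDm hout hin).precomp (g := fun p : Fin N × Fin n => (p.2, p.1))
    fun a b hab => by
      simp only [Prod.mk.injEq] at hab
      exact Prod.ext hab.2 hab.1

/-- The increments of an `n`-dimensional Brownian motion over a uniform grid of mesh `h`,
multiplied by `c`, are independent Gaussian vectors with variance `c² h`. -/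
lemma map_increments_eq_pi [IsProbabilityMeasure P] (hW : IsBrownianVec P W)
    (N : ℕ) (h : ℝ≥0) (c : ℝ) :
    P.map (fun ω (k : Fin N) => c • (W ((k + 1 : ℕ) * h) ω - W ((k : ℕ) * h) ω)) =
      Measure.pi fun _ : Fin N => isoGaussian n (.mk (c ^ 2) (sq_nonneg _) * h) := by
  have hWm := hW.measurable
  let D : Ω → Fin N × Fin n → ℝ := fun ω p =>
    c * (W ((p.1 + 1 : ℕ) * h) ω p.2 - W ((p.1 : ℕ) * h) ω p.2)
  have hDm : ∀ p, Measurable fun ω => D ω p := fun p => by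
    have h1 := hWm ((p.1 + 1 : ℕ) * h)
    have h2 := hWm ((p.1 : ℕ) * h)
    fun_prop
  have hDm' : Measurable D := measurable_pi_lambda _ hDm
  have hmap : P.map D = Measure.pi fun _ => gaussianReal 0 (.mk (c ^ 2) (sq_nonneg _) * h) := by
    rw [iIndepFun.map_fun_eq_pi_map (fun p => (hDm p).aemeasurable)
      (iIndepFun_coord_increments hW N h c)]
    congr 1
    ext1 p
    exact map_coord_increment hW p.1 h c p.2
  have hcurry := Measure.infinitePi_map_curry
    (fun (_ : Fin N) (_ : Fin n) => gaussianReal 0 (.mk (c ^ 2) (sq_nonneg _) * h))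
  simp only [Measure.infinitePi_eq_pi] at hcurry
  have hfun : (fun ω (k : Fin N) => c • (W ((k + 1 : ℕ) * h) ω - W ((k : ℕ) * h) ω)) =
      (fun (x : Fin N → Fin n → ℝ) k => WithLp.toLp 2 (x k)) ∘
        MeasurableEquiv.curry (Fin N) (Fin n) ℝ ∘ D := by
    ext ω k i
    simp [D]
  have hlp : Measurable fun (x : Fin N → Fin n → ℝ) k => WithLp.toLp 2 (x k) := by fun_prop
  unfold isoGaussian
  rw [← Measure.pi_map_pi (fun _ => by fun_prop), ← hcurry, ← hmap,
    Measure.map_map (MeasurableEquiv.measurable _) hDm',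
    Measure.map_map hlp ((MeasurableEquiv.measurable _).comp hDm'), hfun]

end Increments

/-! ### The Euler scheme -/

section Euler

variable {E : Type*} [NormedAddCommGroup E] [NormedSpace ℝ E]

/-- The Euler chain `y₀ = x`, `y_{k+1} = y_k - h b(y_k) + ζ_k` with drift `-b`, step size `h` and
noise `ζ`, as a path with `N + 1` points. -/
def eulerPath (b : E → E) (h : ℝ) : (N : ℕ) → E → (Fin N → E) → Fin (N + 1) → E
  | 0, x, _ => fun _ => x
  | N + 1, x, ζ => Fin.cons x (eulerPath b h N (x - h • b x + ζ 0) (Fin.tail ζ))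

lemma eulerPath_zero (b : E → E) (h : ℝ) (N : ℕ) (x : E) (ζ : Fin N → E) :
    eulerPath b h N x ζ 0 = x := by
  cases N <;> simp [eulerPath]

lemma eulerPath_succ (b : E → E) (h : ℝ) (N : ℕ) (x : E) (ζ : Fin N → E) (k : Fin N) :
    eulerPath b h N x ζ k.succ =
      eulerPath b h N x ζ k.castSucc - h • b (eulerPath b h N x ζ k.castSucc) + ζ k := by
  induction N generalizing x with
  | zero => exact k.elim0
  | succ N ih =>
    refine Fin.cases ?_ (fun j => ?_) k
    · simp [eulerPath, eulerPath_zero]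
    · rw [← Fin.succ_castSucc]
      simp only [eulerPath, Fin.cons_succ]
      exact ih _ _ j

lemma measurable_eulerPath [MeasurableSpace E] [BorelSpace E] [SecondCountableTopology E]
    {b : E → E} (hb : Measurable b) (h : ℝ) (N : ℕ) :
    Measurable fun p : E × (Fin N → E) => eulerPath b h N p.1 p.2 := by
  induction N with
  | zero => exact measurable_pi_lambda _ fun _ => measurable_fst
  | succ N ih =>
    refine measurable_pi_lambda _ fun k => Fin.cases ?_ (fun j => ?_) k
    · simpa [eulerPath] using measurable_fst
    · simp only [eulerPath, Fin.cons_succ]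
      have : Measurable fun p : E × (Fin (N + 1) → E) =>
          (p.1 - h • b p.1 + p.2 0, Fin.tail p.2) := by
        refine Measurable.prodMk (by fun_prop) (measurable_pi_lambda _ fun i => ?_)
        simp only [Fin.tail]
        fun_prop
      exact (measurable_pi_apply j).comp (ih.comp this)

lemma _root_.Measurable.eulerPath [MeasurableSpace E] [BorelSpace E] [SecondCountableTopology E]
    {α : Type*} [MeasurableSpace α] {b : E → E} (hb : Measurable b) (h : ℝ) {N : ℕ}
    {f : α → E} {g : α → Fin N → E} (hf : Measurable f) (hg : Measurable g) :
    Measurable fun a => eulerPath b h N (f a) (g a) :=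
  (measurable_eulerPath hb h N).comp (hf.prodMk hg)

/-- A linear map that commutes with the drift maps Euler chains to Euler chains. -/
lemma eulerPath_map {b : E → E} (U : E ≃ₗᵢ[ℝ] E) (hU : ∀ x, b (U x) = U (b x)) (h : ℝ) (N : ℕ)
    (x : E) (ζ : Fin N → E) (k : Fin (N + 1)) :
    eulerPath b h N (U x) (fun i => U (ζ i)) k = U (eulerPath b h N x ζ k) := by
  induction N generalizing x with
  | zero => rfl
  | succ N ih =>
    refine Fin.cases ?_ (fun j => ?_) k
    · simp [eulerPath]
    · simp only [eulerPath, Fin.cons_succ]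
      rw [← ih, hU]
      congr 1
      simp

variable [CompleteSpace E]

/-- If `X` solves `X_t = X_0 - ∫₀ᵗ b(X_s) ds + w_t` for all times, then the Euler chains that start
at `X_0` and are driven by the increments of `w` follow `X` on `[0, T]`, as the mesh goes to zero:
they stay bounded, their increments are uniformly small, and they end near `X_T`. -/
theorem eulerPath_tendsto {b : E → E} (hb : Continuous b)
    (hLip : ∀ R : ℝ, ∃ L : ℝ, 0 ≤ L ∧ ∀ x y, ‖x‖ ≤ R → ‖y‖ ≤ R → ‖b x - b y‖ ≤ L * ‖x - y‖)
    {X w : ℝ≥0 → E} (hX : Continuous X)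
    (heq : ∀ t : ℝ≥0, X t = X 0 - (∫ s in (0 : ℝ)..t, b (X s.toNNReal)) + w t) (T : ℝ≥0) :
    ∃ R : ℝ, ∀ ε : ℝ, 0 < ε → ∀ᶠ N : ℕ in atTop,
      let y := eulerPath b (T / N) N (X 0)
        (fun k => w ((k + 1 : ℕ) * (T / N)) - w ((k : ℕ) * (T / N)))
      (∀ k, ‖y k‖ ≤ R) ∧ (∀ k : Fin N, ‖y k.succ - y k.castSucc‖ ≤ ε) ∧
        ‖y (Fin.last N) - X T‖ ≤ ε := by
  set f : ℝ → E := fun s => X s.toNNReal with hf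
  have hfc : Continuous f := hX.comp continuous_real_toNNReal
  have hcomp : IsCompact (Icc (0 : ℝ) T) := isCompact_Icc
  obtain ⟨R, hR⟩ := hcomp.exists_bound_of_continuousOn hfc.continuousOn
  obtain ⟨L, hL0, hL⟩ := hLip (R + 1)
  have huc := Metric.uniformContinuousOn_iff.1
    (hcomp.uniformContinuousOn_of_continuous hfc.continuousOn)
  refine ⟨R + 1, fun ε hε => ?_⟩
  -- the modulus of continuity `m` of `X` is amplified by at most `exp (L T)`
  set ε' : ℝ := min (ε / 3) 1 with hε'
  have hε'0 : 0 < ε' := by positivity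
  set m : ℝ := ε' * Real.exp (-(L * T)) with hm
  have hm0 : 0 < m := by positivity
  have hmε : m ≤ ε' := by
    rw [hm]
    refine mul_le_of_le_one_right hε'0.le (Real.exp_le_one_iff.2 ?_)
    have : 0 ≤ L * T := by positivity
    linarith
  obtain ⟨δ, hδ, huc⟩ := huc m hm0
  have hlim : Tendsto (fun N : ℕ => (T : ℝ) / N) atTop (𝓝 0) :=
    tendsto_const_div_atTop_nhds_zero_nat _
  filter_upwards [hlim.eventually_lt_const hδ, eventually_gt_atTop 0] with N hN hN0
  have hN0' : (0 : ℝ) < N := by exact_mod_cast hN0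
  set h : ℝ := (T : ℝ) / N with hh
  have hh0 : 0 ≤ h := by positivity
  have hNh : N * h = T := by rw [hh]; field_simp
  intro y
  have hgrid : ∀ k : ℕ, (((k : ℝ≥0) * (T / N) : ℝ≥0) : ℝ) = k * h := fun k => by
    push_cast; rfl
  have hfgrid : ∀ k : ℕ, f (k * h) = X ((k : ℝ≥0) * (T / N)) := fun k => by
    simp only [hf]
    rw [← hgrid, Real.toNNReal_coe]
  have hle : ∀ k : ℕ, k ≤ N → (k : ℝ) * h ≤ T := fun k hk => by
    rw [← hNh]; gcongr
  have hnn : ∀ k : ℕ, 0 ≤ (k : ℝ) * h := fun k => by positivity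
  have hint : ∀ a c, IntervalIntegrable (fun s => b (f s)) volume a c := fun a c =>
    (hb.comp hfc).intervalIntegrable a c
  have hstep : ∀ k : ℕ, w ((k + 1 : ℕ) * (T / N)) - w ((k : ℕ) * (T / N)) =
      f ((k + 1 : ℕ) * h) - f (k * h) + ∫ s in (k * h)..((k + 1 : ℕ) * h), b (f s) := by
    intro k
    rw [hfgrid, hfgrid, heq ((k + 1 : ℕ) * (T / N)), heq ((k : ℕ) * (T / N)), hgrid, hgrid,
      ← intervalIntegral.integral_add_adjacent_intervals (hint 0 (k * h)) (hint (k * h) _)]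
    simp only [hf]
    abel
  have hpow : ∀ k : ℕ, k ≤ N → m * ((1 + h * L) ^ k - 1) ≤ ε' := by
    intro k hk
    have h1 : (1 + h * L) ^ k ≤ Real.exp (L * T) := by
      calc (1 + h * L) ^ k ≤ Real.exp (h * L) ^ k := by
            gcongr; linarith [Real.add_one_le_exp (h * L)]
        _ = Real.exp (k * h * L) := by rw [← Real.exp_nat_mul]; ring_nf
        _ ≤ _ := by
            rw [Real.exp_le_exp, mul_comm]
            exact mul_le_mul_of_nonneg_left (hle k hk) hL0
    calc m * ((1 + h * L) ^ k - 1) ≤ m * Real.exp (L * T) := by gcongr; linarith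
      _ = ε' := by rw [hm, mul_assoc, ← Real.exp_add]; simp
  have herr : ∀ k : Fin (N + 1), ‖y k - f ((k : ℕ) * h)‖ ≤ m * ((1 + h * L) ^ (k : ℕ) - 1) := by
    intro k
    induction k using Fin.induction with
    | zero => simp [y, eulerPath_zero, hf]
    | succ k ih =>
      have hkN : (k : ℕ) + 1 ≤ N := k.2
      simp only [Fin.val_castSucc, Fin.val_succ] at ih ⊢
      set u := y k.castSucc with hu
      have hfk : ‖f (k * h)‖ ≤ R := hR _ ⟨hnn _, hle k (by omega)⟩
      have hub : ‖u‖ ≤ R + 1 := by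
        calc ‖u‖ = ‖(u - f (k * h)) + f (k * h)‖ := by simp
          _ ≤ _ := norm_add_le _ _
          _ ≤ 1 + R := add_le_add ((ih.trans (hpow k (by omega))).trans (min_le_right _ _)) hfk
          _ = _ := add_comm _ _
      have hkk : (k : ℝ) * h ≤ (k + 1 : ℕ) * h := by push_cast; nlinarith
      have hdiff : ((k + 1 : ℕ) : ℝ) * h - k * h = h := by push_cast; ring
      have hI : h • b u - ∫ s in (k * h)..((k + 1 : ℕ) * h), b (f s) =
          ∫ s in (k * h)..((k + 1 : ℕ) * h), (b u - b (f s)) := by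
        rw [intervalIntegral.integral_sub (by simp) (hint _ _), intervalIntegral.integral_const,
          hdiff]
      have hIb : ‖h • b u - ∫ s in (k * h)..((k + 1 : ℕ) * h), b (f s)‖ ≤
          L * (‖u - f (k * h)‖ + m) * h := by
        rw [hI]
        refine (intervalIntegral.norm_integral_le_of_norm_le_const (C := L * (‖u - f (k * h)‖ + m))
          fun s hs => ?_).trans_eq (by rw [hdiff, abs_of_nonneg hh0])
        rw [uIoc_of_le hkk] at hs
        have hsT : s ∈ Icc (0 : ℝ) T := ⟨(hnn _).trans hs.1.le, hs.2.trans (hle _ hkN)⟩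
        have hdist : dist (f (k * h)) (f s) < m := by
          refine huc _ ⟨hnn _, hle k (by omega)⟩ _ hsT ?_
          rw [Real.dist_eq, abs_sub_comm, abs_of_nonneg (by linarith [hs.1])]
          linarith [hs.2]
        rw [dist_eq_norm] at hdist
        refine (hL _ _ hub ((hR _ hsT).trans (by linarith))).trans ?_
        gcongr
        calc ‖u - f s‖ = ‖(u - f (k * h)) + (f (k * h) - f s)‖ := by abel_nf
          _ ≤ _ := (norm_add_le _ _).trans (by linarith)
      have hrec : y k.succ - f ((k + 1 : ℕ) * h) = (u - f (k * h)) -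
          (h • b u - ∫ s in (k * h)..((k + 1 : ℕ) * h), b (f s)) := by
        simp only [y]
        rw [eulerPath_succ, hstep]
        simp only [hu, y]
        abel
      rw [hrec]
      calc _ ≤ ‖u - f (k * h)‖ + L * (‖u - f (k * h)‖ + m) * h :=
            (norm_sub_le _ _).trans (by gcongr)
        _ = (1 + h * L) * ‖u - f (k * h)‖ + h * L * m := by ring
        _ ≤ (1 + h * L) * (m * ((1 + h * L) ^ (k : ℕ) - 1)) + h * L * m := by gcongr
        _ = _ := by ring
  have herr' : ∀ k : Fin (N + 1), ‖y k - f ((k : ℕ) * h)‖ ≤ ε' :=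
    fun k => (herr k).trans (hpow k (by omega))
  refine ⟨fun k => ?_, fun k => ?_, ?_⟩
  · calc ‖y k‖ = ‖(y k - f ((k : ℕ) * h)) + f ((k : ℕ) * h)‖ := by simp
      _ ≤ _ := norm_add_le _ _
      _ ≤ 1 + R := add_le_add ((herr' k).trans (min_le_right _ _))
          (hR _ ⟨hnn _, hle k (by omega)⟩)
      _ = _ := add_comm _ _
  · have h1 := herr' k.succ
    have h2 := herr' k.castSucc
    simp only [Fin.val_castSucc, Fin.val_succ] at h1 h2
    have h3 : dist (f ((k + 1 : ℕ) * h)) (f (k * h)) < m := by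
      refine huc _ ⟨hnn _, hle _ k.2⟩ _ ⟨hnn _, hle k (by omega)⟩ ?_
      rw [Real.dist_eq, abs_of_nonneg (by push_cast; linarith)]
      push_cast; linarith
    rw [dist_eq_norm] at h3
    calc ‖y k.succ - y k.castSucc‖ = ‖(y k.succ - f ((k + 1 : ℕ) * h)) -
          (y k.castSucc - f (k * h)) + (f ((k + 1 : ℕ) * h) - f (k * h))‖ := by abel_nf
      _ ≤ ε' + ε' + m := (norm_add_le _ _).trans
          (add_le_add ((norm_sub_le _ _).trans (add_le_add h1 h2)) h3.le)
      _ ≤ ε := by linarith [min_le_left (ε / 3) 1]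
  · have h1 := herr' (Fin.last N)
    simp only [Fin.val_last, hNh] at h1
    have : f T = X T := by simp [hf]
    rw [this] at h1
    linarith [min_le_left (ε / 3) 1]

end Euler

/-! ### Discrete reversibility defect -/

section Defect

variable {E : Type*} [NormedAddCommGroup E] [InnerProductSpace ℝ E]

/-- The logarithm of `e^{-βV(y)} q(y,x) / (e^{-βV(x)} q(x,y))`, where `q` is the transition density
of one Euler step of size `h` with drift `-b` and noise of variance `2h/β`. The first summand is
the error of the trapezoidal rule for `∫ ∇V`, the second one telescopes along a path. -/
noncomputable def stepLogRatio (β h : ℝ) (b : E → E) (V : E → ℝ) (x y : E) : ℝ :=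
  -β * (V y - V x - 1 / 2 * inner ℝ (b x + b y) (y - x)) - β * h / 4 * (‖b y‖ ^ 2 - ‖b x‖ ^ 2)

/-- The sum of `stepLogRatio` along a path. -/
noncomputable def pathLogRatio (β h : ℝ) (b : E → E) (V : E → ℝ) {N : ℕ} (y : Fin (N + 1) → E) :
    ℝ :=
  ∑ k : Fin N, stepLogRatio β h b V (y k.castSucc) (y k.succ)

lemma sum_sub_fin {N : ℕ} (g : Fin (N + 1) → ℝ) :
    ∑ k : Fin N, (g k.succ - g k.castSucc) = g (Fin.last N) - g 0 := by
  induction N with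
  | zero => simp
  | succ N ih =>
    rw [Fin.sum_univ_castSucc]
    have := ih (fun k => g k.castSucc)
    simp only [Fin.succ_castSucc] at this ⊢
    rw [this]
    simp

lemma norm_sub_le_of_contDiff [FiniteDimensional ℝ E] {b : E → E} (hb : ContDiff ℝ 1 b) (R : ℝ) :
    ∃ L : ℝ, 0 ≤ L ∧ ∀ x y, ‖x‖ ≤ R → ‖y‖ ≤ R → ‖b x - b y‖ ≤ L * ‖x - y‖ := by
  have := FiniteDimensional.proper ℝ E
  obtain ⟨C, hC⟩ := (isCompact_closedBall (0 : E) R).exists_bound_of_continuousOn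
    (hb.continuous_fderiv (by norm_num)).continuousOn
  refine ⟨max C 0, le_max_right _ _, fun x y hx hy => ?_⟩
  refine (convex_closedBall (0 : E) R).norm_image_sub_le_of_norm_fderiv_le
    (fun z _ => (hb.differentiable (by norm_num)) z) (fun z hz => (hC z hz).trans (le_max_left _ _))
    (by simpa using hy) (by simpa using hx)

/-- The trapezoidal rule has an error of second order that is `o(|y - x|²)`, locally uniformly,
because the potential is `C²`. -/
lemma trapezoid_error [FiniteDimensional ℝ E] {b : E → E} {V : E → ℝ} (hb : ContDiff ℝ 1 b)
    (hV : ∀ z, HasFDerivAt V (innerSL ℝ (b z)) z) (R : ℝ) {ε : ℝ} (hε : 0 < ε) :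
    ∃ δ > 0, ∀ x y, ‖x‖ ≤ R → ‖y‖ ≤ R → ‖y - x‖ ≤ δ →
      |V y - V x - 1 / 2 * inner ℝ (b x + b y) (y - x)| ≤ ε * ‖y - x‖ ^ 2 := by
  have := FiniteDimensional.proper ℝ E
  have huc := Metric.uniformContinuousOn_iff.1
    ((isCompact_closedBall (0 : E) R).uniformContinuousOn_of_continuous
      (hb.continuous_fderiv (by norm_num)).continuousOn) ε hε
  obtain ⟨δ, hδ, huc⟩ := huc
  refine ⟨δ / 2, by positivity, fun x y hx hy hxy => ?_⟩
  set Δ := y - x with hΔ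
  have hdb : ∀ z, HasFDerivAt b (fderiv ℝ b z) z := fun z =>
    ((hb.differentiable (by norm_num)) z).hasFDerivAt
  have hline : ∀ s : ℝ, HasDerivAt (fun s : ℝ => x + s • Δ) Δ s := fun s => by
    simpa using ((hasDerivAt_id s).smul_const Δ).const_add x
  have hseg : ∀ s ∈ Icc (0 : ℝ) 1, x + s • Δ ∈ segment ℝ x y := fun s hs => by
    rw [segment_eq_image']
    exact ⟨s, hs, rfl⟩
  have hball : segment ℝ x y ⊆ Metric.closedBall (0 : E) R :=
    (convex_closedBall (0 : E) R).segment_subset (by simpa using hx) (by simpa using hy)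
  have hdiam : ∀ u ∈ segment ℝ x y, ∀ z ∈ segment ℝ x y, dist u z < δ := by
    intro u hu z hz
    rw [segment_eq_image'] at hu hz
    obtain ⟨s, hs, rfl⟩ := hu
    obtain ⟨t, ht, rfl⟩ := hz
    rw [dist_add_left, dist_eq_norm, ← sub_smul, norm_smul, Real.norm_eq_abs]
    have : |s - t| ≤ 1 := by
      rw [abs_le]; constructor <;> linarith [hs.1, hs.2, ht.1, ht.2]
    have : |s - t| * ‖y - x‖ ≤ 1 * (δ / 2) := by gcongr
    linarith
  have hlin : ∀ s ∈ Icc (0 : ℝ) 1,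
      ‖b (x + s • Δ) - b x - s • fderiv ℝ b (x + s • Δ) Δ‖ ≤ ε * ‖Δ‖ := by
    intro s hs
    have h1 := (convex_segment x y).norm_image_sub_le_of_norm_hasFDerivWithin_le' (f := b)
      (φ := fderiv ℝ b (x + s • Δ)) (C := ε) (fun z _ => (hdb z).hasFDerivWithinAt)
      (fun z hz => by
        have := huc z (hball hz) _ (hball (hseg s hs)) (hdiam z hz _ (hseg s hs))
        rw [dist_eq_norm] at this
        exact this.le) (left_mem_segment ℝ x y) (hseg s hs)
    simp only [add_sub_cancel_left, map_smul] at h1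
    refine h1.trans ?_
    rw [norm_smul, Real.norm_eq_abs, abs_of_nonneg hs.1]
    have : s * ‖Δ‖ ≤ 1 * ‖Δ‖ := by gcongr; exact hs.2
    nlinarith
  have hder : ∀ s : ℝ, HasDerivAt
      (fun s : ℝ => V (x + s • Δ) - V x - 1 / 2 * (s * inner ℝ (b x + b (x + s • Δ)) Δ))
      (1 / 2 * inner ℝ (b (x + s • Δ) - b x - s • fderiv ℝ b (x + s • Δ) Δ) Δ) s := by
    intro s
    have h1 : HasDerivAt (fun s : ℝ => V (x + s • Δ)) (inner ℝ (b (x + s • Δ)) Δ) s :=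
      (hV _).comp_hasDerivAt s (hline s)
    have h2 : HasDerivAt (fun s : ℝ => b x + b (x + s • Δ)) (fderiv ℝ b (x + s • Δ) Δ) s :=
      ((hdb _).comp_hasDerivAt s (hline s)).const_add _
    have h3 := h2.inner ℝ (hasDerivAt_const s Δ)
    have h4 := (h1.sub_const (V x)).sub (((hasDerivAt_id s).mul h3).const_mul (1 / 2))
    refine h4.congr_deriv ?_
    simp only [inner_sub_left, inner_add_left, inner_smul_left, inner_zero_right, id]
    simp
    ring
  have hfin := norm_image_sub_le_of_norm_deriv_le_segment_01' (C := ε * ‖Δ‖ ^ 2)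
    (fun s _ => (hder s).hasDerivWithinAt) (fun s hs => by
      have h1 := hlin s ⟨hs.1, hs.2.le⟩
      have h2 := norm_inner_le_norm (𝕜 := ℝ)
        (b (x + s • Δ) - b x - s • fderiv ℝ b (x + s • Δ) Δ) Δ
      rw [norm_mul]
      have h3 : ‖(1 / 2 : ℝ)‖ ≤ 1 := by norm_num
      have h4 := mul_le_mul_of_nonneg_right h1 (norm_nonneg Δ)
      have h5 : 0 ≤ ‖inner ℝ (b (x + s • Δ) - b x - s • fderiv ℝ b (x + s • Δ) Δ) Δ‖ :=
        norm_nonneg _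
      nlinarith)
  simpa [hΔ] using hfin

/-- Along a bounded Euler path with small increments the reversibility defect is controlled by the
quadratic variation of the noise. -/
lemma abs_pathLogRatio_le {β h B R ε δ : ℝ} (hβ : 0 < β) (hh : 0 ≤ h) {b : E → E}
    {V : E → ℝ} (hB : ∀ x, ‖x‖ ≤ R → ‖b x‖ ≤ B) (hε : 0 < ε)
    (htrap : ∀ x y, ‖x‖ ≤ R → ‖y‖ ≤ R → ‖y - x‖ ≤ δ →
      |V y - V x - 1 / 2 * inner ℝ (b x + b y) (y - x)| ≤ ε * ‖y - x‖ ^ 2)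
    {N : ℕ} {y : Fin (N + 1) → E} {ζ : Fin N → E}
    (hy : ∀ k : Fin N, y k.succ = y k.castSucc - h • b (y k.castSucc) + ζ k)
    (hyR : ∀ k, ‖y k‖ ≤ R) (hyδ : ∀ k : Fin N, ‖y k.succ - y k.castSucc‖ ≤ δ) :
    |pathLogRatio β h b V y| ≤
      β * ε * (2 * h * (N * h) * B ^ 2 + 2 * ∑ k, ‖ζ k‖ ^ 2) + β * h / 4 * B ^ 2 := by
  have hsplit : pathLogRatio β h b V y =
      -β * ∑ k : Fin N, (V (y k.succ) - V (y k.castSucc) -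
        1 / 2 * inner ℝ (b (y k.castSucc) + b (y k.succ)) (y k.succ - y k.castSucc)) -
      β * h / 4 * (‖b (y (Fin.last N))‖ ^ 2 - ‖b (y 0)‖ ^ 2) := by
    rw [← sum_sub_fin fun k => ‖b (y k)‖ ^ 2]
    simp only [pathLogRatio, stepLogRatio, Finset.sum_sub_distrib, ← Finset.mul_sum]
  have hb2 : ∀ k, ‖b (y k)‖ ^ 2 ≤ B ^ 2 := fun k => by
    have := hB _ (hyR k)
    gcongr
  have h1 : |∑ k : Fin N, (V (y k.succ) - V (y k.castSucc) -
        1 / 2 * inner ℝ (b (y k.castSucc) + b (y k.succ)) (y k.succ - y k.castSucc))| ≤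
      ε * (2 * h * (N * h) * B ^ 2 + 2 * ∑ k, ‖ζ k‖ ^ 2) := by
    calc _ ≤ ∑ k : Fin N, ε * (2 * h ^ 2 * B ^ 2 + 2 * ‖ζ k‖ ^ 2) := by
          refine (Finset.abs_sum_le_sum_abs _ _).trans (Finset.sum_le_sum fun k _ => ?_)
          refine (htrap _ _ (hyR _) (hyR _) (hyδ k)).trans ?_
          gcongr
          have : y k.succ - y k.castSucc = ζ k - h • b (y k.castSucc) := by rw [hy]; abel
          rw [this]
          have h2 := norm_sub_le (ζ k) (h • b (y k.castSucc))
          rw [norm_smul, Real.norm_eq_abs, abs_of_nonneg hh] at h2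
          have h3 := pow_le_pow_left₀ (norm_nonneg _) h2 2
          have h4 := mul_le_mul_of_nonneg_left (hb2 k.castSucc) (sq_nonneg h)
          nlinarith [sq_nonneg (‖ζ k‖ - h * ‖b (y k.castSucc)‖)]
      _ = _ := by
          simp only [← Finset.mul_sum, Finset.sum_add_distrib, Finset.sum_const,
            Finset.card_univ, Fintype.card_fin, nsmul_eq_mul]
          ring
  have h2 : |‖b (y (Fin.last N))‖ ^ 2 - ‖b (y 0)‖ ^ 2| ≤ B ^ 2 := by
    rw [abs_le]
    constructor <;> nlinarith [hb2 0, hb2 (Fin.last N), sq_nonneg ‖b (y 0)‖,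
      sq_nonneg ‖b (y (Fin.last N))‖]
  rw [hsplit]
  refine (abs_sub _ _).trans ?_
  rw [abs_mul, abs_mul, abs_neg, abs_of_pos hβ, abs_of_nonneg (by positivity : 0 ≤ β * h / 4),
    mul_assoc]
  gcongr

/-- Along the Euler approximations of a global solution the reversibility defect is eventually at
most any small multiple of the quadratic variation of the noise (plus one). -/
theorem eventually_abs_pathLogRatio_le [FiniteDimensional ℝ E] {β : ℝ} (hβ : 0 < β) {b : E → E}
    {V : E → ℝ} (hb : ContDiff ℝ 1 b) (hV : ∀ z, HasFDerivAt V (innerSL ℝ (b z)) z)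
    {X w : ℝ≥0 → E} (hX : Continuous X)
    (heq : ∀ t : ℝ≥0, X t = X 0 - (∫ s in (0 : ℝ)..t, b (X s.toNNReal)) + w t) (T : ℝ≥0)
    {ε : ℝ} (hε : 0 < ε) :
    ∀ᶠ N : ℕ in atTop,
      let ζ : Fin N → E := fun k => w ((k + 1 : ℕ) * (T / N)) - w ((k : ℕ) * (T / N))
      |pathLogRatio β (T / N) b V (eulerPath b (T / N) N (X 0) ζ)| ≤ ε * (1 + ∑ k, ‖ζ k‖ ^ 2) := by
  have := FiniteDimensional.complete ℝ E
  have := FiniteDimensional.proper ℝ E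
  obtain ⟨R, hR⟩ := eulerPath_tendsto hb.continuous (norm_sub_le_of_contDiff hb) hX heq T
  obtain ⟨B, hB⟩ := (isCompact_closedBall (0 : E) R).exists_bound_of_continuousOn
    hb.continuous.continuousOn
  set ε' := ε / (2 * β) with hε'
  have hε'0 : 0 < ε' := by positivity
  obtain ⟨δ, hδ, htrap⟩ := trapezoid_error hb hV R hε'0
  have hlim : Tendsto (fun N : ℕ =>
      β * ε' * (2 * ((T : ℝ) / N) * T * B ^ 2) + β * ((T : ℝ) / N) / 4 * B ^ 2) atTop (𝓝 0) := by
    have h0 : Tendsto (fun N : ℕ => (T : ℝ) / N) atTop (𝓝 0) :=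
      tendsto_const_div_atTop_nhds_zero_nat _
    have := ((((h0.const_mul 2).mul_const (T : ℝ)).mul_const (B ^ 2)).const_mul (β * ε')).add
      (((h0.const_mul β).div_const 4).mul_const (B ^ 2))
    simpa using this
  filter_upwards [hR δ hδ, hlim.eventually_lt_const hε, eventually_gt_atTop 0] with N hN hN2 hN0 ζ
  obtain ⟨h1, h2, -⟩ := hN
  have hN0' : (N : ℝ) ≠ 0 := by positivity
  refine (abs_pathLogRatio_le hβ (by positivity) (fun x hx => hB x (by simpa using hx)) hε'0 htrap
    (fun k => eulerPath_succ b _ N (X 0) ζ k) h1 h2).trans ?_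
  have hβε : β * ε' * 2 = ε := by rw [hε']; field_simp
  have hNT : (N : ℝ) * ((T : ℝ) / N) = T := by field_simp
  rw [hNT]
  have : β * ε' * (2 * ∑ k, ‖ζ k‖ ^ 2) = ε * ∑ k, ‖ζ k‖ ^ 2 := by rw [← hβε]; ring
  linarith

end Defect

/-! ### Path densities and reversibility -/

section PathDensity

lemma lintegral_pi_succ {α : Type*} [MeasurableSpace α] (μ : Measure α) [SigmaFinite μ] (N : ℕ)
    {f : (Fin (N + 1) → α) → ℝ≥0∞} (hf : Measurable f) :
    ∫⁻ y, f y ∂(Measure.pi fun _ => μ) =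
      ∫⁻ a, ∫⁻ y : Fin N → α, f (Fin.cons a y) ∂(Measure.pi fun _ => μ) ∂μ := by
  have h := (measurePreserving_piFinSuccAbove (fun _ : Fin (N + 1) => μ) 0).symm
  have hcons : ∀ (a : α) (y : Fin N → α),
      (MeasurableEquiv.piFinSuccAbove (fun _ => α) 0).symm (a, y) = Fin.cons a y := fun a y => by
    ext1 k
    refine Fin.cases rfl (fun j => rfl) k
  rw [← h.lintegral_comp hf, lintegral_prod _ (by fun_prop)]
  simp only [hcons]

variable {n : ℕ}

/-- The transition density of one Euler step with drift `-b` and noise variance `v`. -/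
noncomputable def stepDensity (v : ℝ≥0) (h : ℝ)
    (b : EuclideanSpace ℝ (Fin n) → EuclideanSpace ℝ (Fin n)) (x y : EuclideanSpace ℝ (Fin n)) :
    ℝ :=
  isoGaussianPDF n v (y - (x - h • b x))

lemma measurable_stepDensity (v : ℝ≥0) (h : ℝ)
    {b : EuclideanSpace ℝ (Fin n) → EuclideanSpace ℝ (Fin n)} (hb : Measurable b) {α : Type*}
    [MeasurableSpace α] {f g : α → EuclideanSpace ℝ (Fin n)} (hf : Measurable f)
    (hg : Measurable g) : Measurable fun a => stepDensity v h b (f a) (g a) :=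
  (continuous_isoGaussianPDF n v).measurable.comp
    (hg.sub (hf.sub ((hb.comp hf).const_smul h)))

lemma lintegral_isoGaussian_add {v : ℝ≥0} (hv : v ≠ 0) (a : EuclideanSpace ℝ (Fin n))
    {H : EuclideanSpace ℝ (Fin n) → ℝ≥0∞} (hH : Measurable H) :
    ∫⁻ z, H (a + z) ∂(isoGaussian n v) =
      ∫⁻ z, ENNReal.ofReal (isoGaussianPDF n v (z - a)) * H z := by
  have hg := continuous_isoGaussianPDF n v
  rw [isoGaussian_eq_withDensity n hv, lintegral_withDensity_eq_lintegral_mul _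
    (f := fun z => ENNReal.ofReal (isoGaussianPDF n v z)) (by fun_prop)
    (g := fun z => H (a + z)) (hH.comp (measurable_const_add a)), ← lintegral_sub_right_eq_self _ a]
  simp

/-- The law of the Euler chain, started from a measure with density `w`, has the product of the
transition densities as its density with respect to Lebesgue measure on path space. -/
lemma lintegral_eulerPath {v : ℝ≥0} (hv : v ≠ 0) (h : ℝ)
    {b : EuclideanSpace ℝ (Fin n) → EuclideanSpace ℝ (Fin n)} (hb : Measurable b) (N : ℕ)
    {w : EuclideanSpace ℝ (Fin n) → ℝ≥0∞} (hw : Measurable w)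
    {F : (Fin (N + 1) → EuclideanSpace ℝ (Fin n)) → ℝ≥0∞} (hF : Measurable F) :
    ∫⁻ x, w x * ∫⁻ ζ, F (eulerPath b h N x ζ) ∂(Measure.pi fun _ => isoGaussian n v) =
      ∫⁻ y, w (y 0) * F y *
        ∏ k : Fin N, ENNReal.ofReal (stepDensity v h b (y k.castSucc) (y k.succ)) := by
  induction N generalizing w with
  | zero =>
    simp only [eulerPath, lintegral_const, measure_univ, mul_one, Finset.univ_eq_empty,
      Finset.prod_empty]
    have := (volume_preserving_funUnique (Fin 1) (EuclideanSpace ℝ (Fin n))).symm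
    exact this.lintegral_comp (f := fun y => w (y 0) * F y) (by fun_prop)
  | succ N ih =>
    have hg := continuous_isoGaussianPDF n v
    have hcons : Measurable fun p : EuclideanSpace ℝ (Fin n) ×
        (Fin (N + 1) → EuclideanSpace ℝ (Fin n)) =>
        (Fin.cons p.1 p.2 : Fin (N + 2) → EuclideanSpace ℝ (Fin n)) := by
      refine measurable_pi_lambda _ fun k => Fin.cases ?_ (fun j => ?_) k
      · simpa using measurable_fst
      · simp only [Fin.cons_succ]; fun_prop
    have hFc : ∀ x, Measurable fun y : Fin (N + 1) → EuclideanSpace ℝ (Fin n) =>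
        F (Fin.cons x y) := fun x =>
      hF.comp (hcons.comp (measurable_const.prodMk measurable_id))
    have hprod : ∀ M : ℕ, Measurable fun y : Fin (M + 1) → EuclideanSpace ℝ (Fin n) =>
        ∏ k : Fin M, ENNReal.ofReal (stepDensity v h b (y k.castSucc) (y k.succ)) := fun M =>
      Finset.measurable_fun_prod _ fun k _ =>
        (measurable_stepDensity v h hb (f := fun y : Fin (M + 1) → EuclideanSpace ℝ (Fin n) =>
          y k.castSucc) (by fun_prop) (by fun_prop)).ennreal_ofReal
    have hq : ∀ x, Measurable fun x₁ => ENNReal.ofReal (stepDensity v h b x x₁) := fun x =>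
      (measurable_stepDensity v h hb measurable_const measurable_id).ennreal_ofReal
    have hrhs : Measurable fun y : Fin (N + 2) → EuclideanSpace ℝ (Fin n) => w (y 0) * F y *
        ∏ k : Fin (N + 1), ENNReal.ofReal (stepDensity v h b (y k.castSucc) (y k.succ)) :=
      Measurable.mul (by fun_prop) (hprod (N + 1))
    rw [volume_pi, lintegral_pi_succ _ _ hrhs]
    refine lintegral_congr fun x => ?_
    -- one step of the chain: substitute `x₁ = x - h b(x) + ζ₀`
    have hstep : ∫⁻ ζ, F (eulerPath b h (N + 1) x ζ) ∂(Measure.pi fun _ => isoGaussian n v) =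
        ∫⁻ x₁, ENNReal.ofReal (stepDensity v h b x x₁) *
          ∫⁻ ζ, F (Fin.cons x (eulerPath b h N x₁ ζ)) ∂(Measure.pi fun _ => isoGaussian n v) := by
      have hmeas : Measurable fun x₁ => ∫⁻ ζ, F (Fin.cons x (eulerPath b h N x₁ ζ))
          ∂(Measure.pi fun _ => isoGaussian n v) :=
        Measurable.lintegral_prod_right' (f := fun p : EuclideanSpace ℝ (Fin n) ×
          (Fin N → EuclideanSpace ℝ (Fin n)) => F (Fin.cons x (eulerPath b h N p.1 p.2)))
          ((hFc x).comp (measurable_eulerPath hb h N))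
      have hmeas' : Measurable fun ζ => F (eulerPath b h (N + 1) x ζ) :=
        hF.comp (Measurable.eulerPath hb h measurable_const measurable_id)
      rw [lintegral_pi_succ _ _ hmeas']
      simp only [eulerPath, Fin.cons_zero, Fin.tail_cons]
      exact lintegral_isoGaussian_add hv _ hmeas
    rw [hstep, ih (hq x) (hFc x), volume_pi,
      ← lintegral_const_mul]
    · refine lintegral_congr fun y => ?_
      rw [Fin.prod_univ_succ]
      simp only [Fin.cons_zero, Fin.castSucc_zero, Fin.cons_succ, ← Fin.succ_castSucc]
      ring
    · exact (((hq x).comp (measurable_pi_apply 0)).mul (hFc x)).mul (hprod N)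

variable {β h : ℝ} {v : ℝ≥0} {b : EuclideanSpace ℝ (Fin n) → EuclideanSpace ℝ (Fin n)}
  {V : EuclideanSpace ℝ (Fin n) → ℝ}

lemma stepDensity_swap (hh : 0 < h) (hβ : 0 < β) (hv : β * v = 2 * h)
    (x y : EuclideanSpace ℝ (Fin n)) :
    stepDensity v h b y x =
      stepDensity v h b x y * Real.exp (stepLogRatio β h b V x y + β * (V y - V x)) := by
  have hv0 : (v : ℝ) = 2 * h / β := by field_simp; linarith
  have e1 : x - (y - h • b y) = h • b y - (y - x) := by abel
  have e2 : y - (x - h • b x) = h • b x + (y - x) := by abel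
  unfold stepDensity isoGaussianPDF stepLogRatio
  rw [mul_assoc _ (Real.exp _), ← Real.exp_add, e1, e2, norm_sub_sq_real, norm_add_sq_real, hv0]
  congr 2
  simp only [norm_smul, inner_smul_left, inner_add_left, Real.norm_eq_abs, mul_pow, sq_abs]
  simp only [conj_trivial]
  field_simp
  ring

lemma stepLogRatio_swap (x y : EuclideanSpace ℝ (Fin n)) :
    stepLogRatio β h b V y x = -stepLogRatio β h b V x y := by
  unfold stepLogRatio
  rw [← neg_sub y x, inner_neg_right, add_comm (b y)]
  ring

lemma pathLogRatio_rev {N : ℕ} (y : Fin (N + 1) → EuclideanSpace ℝ (Fin n)) :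
    pathLogRatio β h b V (fun k => y k.rev) = -pathLogRatio β h b V y := by
  unfold pathLogRatio
  rw [← Finset.sum_neg_distrib, ← Equiv.sum_comp Fin.revPerm]
  refine Finset.sum_congr rfl fun k _ => ?_
  simp [Fin.rev_castSucc, Fin.rev_succ, stepLogRatio_swap (y k.castSucc)]

/-- The density of the Euler path started from the Gibbs measure. -/
noncomputable def pathDensity (β : ℝ) (v : ℝ≥0) (h : ℝ)
    (b : EuclideanSpace ℝ (Fin n) → EuclideanSpace ℝ (Fin n)) (V : EuclideanSpace ℝ (Fin n) → ℝ)
    {N : ℕ} (y : Fin (N + 1) → EuclideanSpace ℝ (Fin n)) : ℝ :=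
  Real.exp (-β * V (y 0)) * ∏ k : Fin N, stepDensity v h b (y k.castSucc) (y k.succ)

lemma pathDensity_rev (hh : 0 < h) (hβ : 0 < β) (hv : β * v = 2 * h) {N : ℕ}
    (y : Fin (N + 1) → EuclideanSpace ℝ (Fin n)) :
    pathDensity β v h b V (fun k => y k.rev) =
      pathDensity β v h b V y * Real.exp (pathLogRatio β h b V y) := by
  have hprod : ∏ k : Fin N, stepDensity v h b (y k.castSucc.rev) (y k.succ.rev) =
      (∏ k : Fin N, stepDensity v h b (y k.castSucc) (y k.succ)) *
        Real.exp (pathLogRatio β h b V y + β * (V (y (Fin.last N)) - V (y 0))) := by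
    rw [← Equiv.prod_comp Fin.revPerm, ← sum_sub_fin fun k => V (y k), pathLogRatio,
      Finset.mul_sum, ← Finset.sum_add_distrib, Real.exp_sum, ← Finset.prod_mul_distrib]
    refine Finset.prod_congr rfl fun k _ => ?_
    simp only [Fin.revPerm_apply, Fin.rev_castSucc, Fin.rev_succ, Fin.rev_rev]
    exact stepDensity_swap hh hβ hv _ _
  unfold pathDensity
  simp only [Fin.rev_zero]
  rw [hprod, mul_left_comm, ← Real.exp_add, mul_right_comm, ← Real.exp_add, mul_comm]
  congr 2
  ring

lemma measurable_pathLogRatio (hb : Measurable b) (hV : Measurable V) (N : ℕ) :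
    Measurable fun y : Fin (N + 1) → EuclideanSpace ℝ (Fin n) => pathLogRatio β h b V y := by
  unfold pathLogRatio stepLogRatio
  fun_prop

/-- The weight `min (1, ρ(reversed path) / ρ(path))` of a path, where `ρ` is the path density
of the Euler chain started from the Gibbs measure. -/
noncomputable def reversalWeight (β h : ℝ)
    (b : EuclideanSpace ℝ (Fin n) → EuclideanSpace ℝ (Fin n)) (V : EuclideanSpace ℝ (Fin n) → ℝ)
    {N : ℕ} (y : Fin (N + 1) → EuclideanSpace ℝ (Fin n)) : ℝ :=
  min 1 (Real.exp (pathLogRatio β h b V y))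

lemma measurable_reversalWeight (hb : Measurable b) (hV : Measurable V) (N : ℕ) :
    Measurable fun y : Fin (N + 1) → EuclideanSpace ℝ (Fin n) => reversalWeight β h b V y :=
  measurable_const.min (measurable_pathLogRatio hb hV N).exp

/-- The transition operator of `N` steps of the Euler scheme, with every path weighted by
its `reversalWeight`. The weight makes the operator exactly symmetric for the Gibbs measure. -/
noncomputable def symmetrizedEuler (β : ℝ) (v : ℝ≥0) (h : ℝ)
    (b : EuclideanSpace ℝ (Fin n) → EuclideanSpace ℝ (Fin n)) (V : EuclideanSpace ℝ (Fin n) → ℝ)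
    (N : ℕ) (g : EuclideanSpace ℝ (Fin n) → ℝ≥0∞) (x : EuclideanSpace ℝ (Fin n)) : ℝ≥0∞ :=
  ∫⁻ ζ, g (eulerPath b h N x ζ (Fin.last N)) *
    ENNReal.ofReal (reversalWeight β h b V (eulerPath b h N x ζ))
    ∂(Measure.pi fun _ => isoGaussian n v)

lemma measurable_symmetrizedEuler (hb : Measurable b) (hV : Measurable V) (N : ℕ)
    {g : EuclideanSpace ℝ (Fin n) → ℝ≥0∞} (hg : Measurable g) :
    Measurable (symmetrizedEuler β v h b V N g) := by
  have hL := measurable_reversalWeight (β := β) (h := h) hb hV N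
  have hG : Measurable fun y : Fin (N + 1) → EuclideanSpace ℝ (Fin n) =>
    g (y (Fin.last N)) * ENNReal.ofReal (reversalWeight β h b V y) := by fun_prop
  exact Measurable.lintegral_prod_right' (hG.comp (measurable_eulerPath hb h N))

/-- Path reversal shows that the weighted Euler operator is symmetric. -/
theorem lintegral_symmetrizedEuler_comm (hh : 0 < h) (hβ : 0 < β) (hv : β * v = 2 * h)
    (hb : Measurable b) (hV : Measurable V) (N : ℕ) {f g : EuclideanSpace ℝ (Fin n) → ℝ≥0∞}
    (hf : Measurable f) (hg : Measurable g) :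
    ∫⁻ x, f x * symmetrizedEuler β v h b V N g x ∂(gibbsMeasure β V) =
      ∫⁻ x, g x * symmetrizedEuler β v h b V N f x ∂(gibbsMeasure β V) := by
  have hv0 : v ≠ 0 := by
    rintro rfl
    simp at hv
    linarith
  have key : ∀ {f g : EuclideanSpace ℝ (Fin n) → ℝ≥0∞}, Measurable f → Measurable g →
      ∫⁻ x, f x * symmetrizedEuler β v h b V N g x ∂(gibbsMeasure β V) =
      ∫⁻ y : Fin (N + 1) → EuclideanSpace ℝ (Fin n), f (y 0) * g (y (Fin.last N)) *
        ENNReal.ofReal (pathDensity β v h b V y *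
          reversalWeight β h b V y) := by
    intro f g hf hg
    have hL := measurable_reversalWeight (β := β) (h := h) hb hV N
    have hF : Measurable fun y : Fin (N + 1) → EuclideanSpace ℝ (Fin n) => g (y (Fin.last N)) *
        ENNReal.ofReal (reversalWeight β h b V y) := by fun_prop
    rw [gibbsMeasure, lintegral_withDensity_eq_lintegral_mul _
      (f := fun x => ENNReal.ofReal (Real.exp (-β * V x))) (by fun_prop)
      (g := fun x => f x * symmetrizedEuler β v h b V N g x)
      (hf.mul (measurable_symmetrizedEuler hb hV N hg))]
    have h1 := lintegral_eulerPath hv0 h hb N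
      (w := fun x => ENNReal.ofReal (Real.exp (-β * V x)) * f x) (by fun_prop) hF
    simp only [Pi.mul_apply, symmetrizedEuler, ← mul_assoc] at h1 ⊢
    rw [h1]
    refine lintegral_congr fun y => ?_
    have hpos : ∀ k : Fin N, 0 ≤ stepDensity v h b (y k.castSucc) (y k.succ) := fun k =>
      (isoGaussianPDF_pos n hv0 _).le
    rw [pathDensity, ENNReal.ofReal_mul (mul_nonneg (Real.exp_nonneg _)
      (Finset.prod_nonneg fun k _ => hpos k)), ENNReal.ofReal_mul (Real.exp_nonneg _),
      ENNReal.ofReal_prod_of_nonneg fun k _ => hpos k]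
    ring
  rw [key hf hg, key hg hf]
  have hrev := volume_measurePreserving_piCongrLeft
    (fun _ : Fin (N + 1) => EuclideanSpace ℝ (Fin n)) Fin.revPerm
  rw [← hrev.lintegral_comp_emb (MeasurableEquiv.measurableEmbedding _)]
  refine lintegral_congr fun y => ?_
  have hy : MeasurableEquiv.piCongrLeft
      (fun _ : Fin (N + 1) => EuclideanSpace ℝ (Fin n)) Fin.revPerm y = fun k => y k.rev := by
    ext1 k
    have := MeasurableEquiv.piCongrLeft_apply_apply (β := fun _ : Fin (N + 1) =>
      EuclideanSpace ℝ (Fin n)) Fin.revPerm y k.rev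
    simpa using this
  simp only [hy, reversalWeight, pathLogRatio_rev, pathDensity_rev hh hβ hv, Fin.rev_zero,
    Fin.rev_last]
  rw [mul_comm (f _) (g _), mul_assoc (pathDensity β v h b V y), mul_min_of_nonneg _ _
    (Real.exp_nonneg _), ← Real.exp_add]
  simp [min_comm]

/-- If the drift and the potential are invariant under the isometry `U`, so is the operator. -/
lemma symmetrizedEuler_comp_isometry (hv : v ≠ 0) (hb : Measurable b) (hV : Measurable V)
    (U : EuclideanSpace ℝ (Fin n) ≃ₗᵢ[ℝ] EuclideanSpace ℝ (Fin n))
    (hbU : ∀ x, b (U x) = U (b x)) (hVU : ∀ x, V (U x) = V x) (N : ℕ)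
    {g : EuclideanSpace ℝ (Fin n) → ℝ≥0∞} (hg : Measurable g) (hgU : ∀ x, g (U x) = g x)
    (x : EuclideanSpace ℝ (Fin n)) :
    symmetrizedEuler β v h b V N g (U x) = symmetrizedEuler β v h b V N g x := by
  have hL := measurable_reversalWeight (β := β) (h := h) hb hV N
  have hG : Measurable fun y : Fin (N + 1) → EuclideanSpace ℝ (Fin n) =>
    g (y (Fin.last N)) * ENNReal.ofReal (reversalWeight β h b V y) := by fun_prop
  have hG' := hG.comp (Measurable.eulerPath hb h (N := N) (measurable_const (a := U x))
    measurable_id)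
  have hmp := measurePreserving_pi (fun _ : Fin N => isoGaussian n v) (fun _ => isoGaussian n v)
    fun _ => measurePreserving_isoGaussian n hv U
  have hLU : ∀ y : Fin (N + 1) → EuclideanSpace ℝ (Fin n),
      pathLogRatio β h b V (fun k => U (y k)) = pathLogRatio β h b V y := fun y => by
    simp only [pathLogRatio, stepLogRatio, hbU, hVU, ← map_sub, ← map_add,
      LinearIsometryEquiv.inner_map_map, LinearIsometryEquiv.norm_map]
  unfold symmetrizedEuler
  refine (hmp.lintegral_comp hG').symm.trans ?_
  refine lintegral_congr fun ζ => ?_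
  have he : eulerPath b h N (U x) (fun i => U (ζ i)) = fun k => U (eulerPath b h N x ζ k) :=
    funext fun k => eulerPath_map U hbU h N x ζ k
  simp only [Function.comp_apply, id, he, hLU, hgU, reversalWeight]

end PathDensity

/-! ### Convergence of the symmetrized Euler scheme -/

section Convergence

lemma inner_gradient {E : Type*} [NormedAddCommGroup E] [InnerProductSpace ℝ E] [CompleteSpace E]
    {V : E → ℝ} {z : E} (hV : DifferentiableAt ℝ V z) : HasFDerivAt V (innerSL ℝ (∇ V z)) z :=
  hV.hasGradientAt.hasFDerivAt

lemma contDiff_gradient {n : ℕ} {V : EuclideanSpace ℝ (Fin n) → ℝ} (hV : ContDiff ℝ 2 V) :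
    ContDiff ℝ 1 (∇ V) := by
  rw [contDiff_euclidean]
  intro i
  have h1 : ContDiff ℝ 1 fun x => fderiv ℝ V x (EuclideanSpace.single i 1) :=
    (hV.fderiv_right (m := 1) (by norm_num)).clm_apply contDiff_const
  have h2 : (fun x => (∇ V) x i) = fun x => fderiv ℝ V x (EuclideanSpace.single i 1) := by
    ext x
    rw [(inner_gradient ((hV.differentiable (by norm_num)) x)).fderiv]
    rw [innerSL_apply_apply, EuclideanSpace.inner_single_right]
    simp only [conj_trivial, one_mul]
  rw [h2]
  exact h1

/-- The variance of the noise in one step of length `h` of the Euler scheme. -/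
noncomputable def noiseVar (β : ℝ) (h : ℝ≥0) : ℝ≥0 := .mk (√(2 / β) ^ 2) (sq_nonneg _) * h

lemma mul_noiseVar {β : ℝ} (hβ : 0 < β) (h : ℝ≥0) : β * noiseVar β h = 2 * h := by
  simp only [noiseVar, NNReal.coe_mul, NNReal.coe_mk]
  rw [Real.sq_sqrt (by positivity)]
  field_simp

variable {n : ℕ} {β : ℝ} {V : EuclideanSpace ℝ (Fin n) → ℝ} {Ω : Type u} [MeasurableSpace Ω]
  {P : Measure Ω} {W X : ℝ≥0 → Ω → EuclideanSpace ℝ (Fin n)}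

/-- The noise of the Euler scheme with `N` steps up to time `T`. -/
noncomputable def brownianNoise (β : ℝ) (W : ℝ≥0 → Ω → EuclideanSpace ℝ (Fin n)) (T : ℝ≥0) (N : ℕ)
    (ω : Ω) (k : Fin N) : EuclideanSpace ℝ (Fin n) :=
  √(2 / β) • (W ((k + 1 : ℕ) * (T / N)) ω - W ((k : ℕ) * (T / N)) ω)

/-- The Euler approximation with `N` steps up to time `T`, started at `X₀`. -/
noncomputable def eulerApprox (β : ℝ) (V : EuclideanSpace ℝ (Fin n) → ℝ)
    (W X : ℝ≥0 → Ω → EuclideanSpace ℝ (Fin n)) (T : ℝ≥0) (N : ℕ) (ω : Ω) :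
    Fin (N + 1) → EuclideanSpace ℝ (Fin n) :=
  eulerPath (∇ V) (T / N) N (X 0 ω) (brownianNoise β W T N ω)

lemma measurable_brownianNoise (hW : ∀ t, Measurable (W t)) (T : ℝ≥0) (N : ℕ) :
    Measurable (brownianNoise β W T N) :=
  measurable_pi_lambda _ fun k =>
    ((hW ((k + 1 : ℕ) * (T / N))).sub (hW ((k : ℕ) * (T / N)))).const_smul (√(2 / β))

/-- The initial value and the noise have a product law, so averages of path functionals over `Ω`
are averages over the abstract Euler chain. -/
lemma lintegral_eulerApprox (hs : IsLangevinSolution β V P W X) (hV : ContDiff ℝ 2 V) (T : ℝ≥0)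
    (N : ℕ) {F : (Fin (N + 1) → EuclideanSpace ℝ (Fin n)) → ℝ≥0∞} (hF : Measurable F) :
    ∫⁻ ω, F (eulerApprox β V W X T N ω) ∂P =
      ∫⁻ x, ∫⁻ ζ, F (eulerPath (∇ V) (T / N) N x ζ)
        ∂(Measure.pi fun _ => isoGaussian n (noiseVar β (T / N))) ∂(P.map (X 0)) := by
  have := hs.isProbabilityMeasure
  have hb : Measurable (∇ V) := (contDiff_gradient hV).continuous.measurable
  have hζ := measurable_brownianNoise (β := β) hs.isBrownianVec.measurable T N
  have hind : IndepFun (X 0) (brownianNoise β W T N) P := by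
    refine hs.indep_initial.comp (φ := id) (ψ := fun (w : ℝ≥0 → EuclideanSpace ℝ (Fin n))
      (k : Fin N) => √(2 / β) • (w ((k + 1 : ℕ) * (T / N)) - w ((k : ℕ) * (T / N))))
      measurable_id (measurable_pi_lambda _ fun k => ?_)
    fun_prop
  have hlaw := hind.map_prod_eq_prod_map_map (hs.measurable 0).aemeasurable hζ.aemeasurable
  have hnoise : P.map (brownianNoise β W T N) =
      Measure.pi fun _ => isoGaussian n (noiseVar β (T / N)) :=
    map_increments_eq_pi hs.isBrownianVec N (T / N) (√(2 / β))
  have hG : Measurable fun p : EuclideanSpace ℝ (Fin n) × (Fin N → EuclideanSpace ℝ (Fin n)) =>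
      F (eulerPath (∇ V) (T / N) N p.1 p.2) := hF.comp (measurable_eulerPath hb _ N)
  rw [← hnoise, ← lintegral_prod (fun p : EuclideanSpace ℝ (Fin n) ×
    (Fin N → EuclideanSpace ℝ (Fin n)) => F (eulerPath (∇ V) (T / N) N p.1 p.2)) hG.aemeasurable,
    ← hlaw, lintegral_map hG ((hs.measurable 0).prodMk hζ)]
  rfl

lemma measurable_eulerApprox (hs : IsLangevinSolution β V P W X) (hV : ContDiff ℝ 2 V) (T : ℝ≥0)
    (N : ℕ) : Measurable (eulerApprox β V W X T N) :=
  Measurable.eulerPath (contDiff_gradient hV).continuous.measurable _ (hs.measurable 0)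
    (measurable_brownianNoise hs.isBrownianVec.measurable T N)

/-- The expected quadratic variation of the noise does not depend on the number of steps. -/
lemma lintegral_sum_brownianNoise_sq (hs : IsLangevinSolution β V P W X) (T : ℝ≥0) {N : ℕ}
    (hN : N ≠ 0) :
    ∫⁻ ω, ENNReal.ofReal (∑ k, ‖brownianNoise β W T N ω k‖ ^ 2) ∂P = n * noiseVar β T := by
  have := hs.isProbabilityMeasure
  have hζ := measurable_brownianNoise (β := β) hs.isBrownianVec.measurable T N
  have hnoise : P.map (brownianNoise β W T N) =
      Measure.pi fun _ => isoGaussian n (noiseVar β (T / N)) :=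
    map_increments_eq_pi hs.isBrownianVec N (T / N) (√(2 / β))
  have h1 : ∀ k : Fin N, ∫⁻ ω, ENNReal.ofReal (‖brownianNoise β W T N ω k‖ ^ 2) ∂P =
      n * noiseVar β (T / N) := by
    intro k
    rw [← lintegral_map (f := fun ζ : Fin N → EuclideanSpace ℝ (Fin n) =>
      ENNReal.ofReal (‖ζ k‖ ^ 2)) (by fun_prop) hζ, hnoise, ← lintegral_norm_sq_isoGaussian]
    exact (measurePreserving_eval (fun _ : Fin N => isoGaussian n (noiseVar β (T / N))) k
      ).lintegral_comp (f := fun z => ENNReal.ofReal (‖z‖ ^ 2)) (by fun_prop)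
  have h2 : ∀ ω, ENNReal.ofReal (∑ k, ‖brownianNoise β W T N ω k‖ ^ 2) =
      ∑ k, ENNReal.ofReal (‖brownianNoise β W T N ω k‖ ^ 2) := fun ω =>
    ENNReal.ofReal_sum_of_nonneg fun k _ => sq_nonneg _
  simp only [h2]
  rw [lintegral_finsetSum _ fun k _ => by fun_prop]
  simp only [h1, Finset.sum_const, Finset.card_univ, Fintype.card_fin, nsmul_eq_mul]
  rw [← mul_assoc, mul_comm (N : ℝ≥0∞), mul_assoc]
  congr 1
  have : (N : ℝ≥0) * noiseVar β (T / N) = noiseVar β T := by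
    have : (N : ℝ≥0) ≠ 0 := by exact_mod_cast hN
    simp only [noiseVar]
    field_simp
  rw [← this]
  push_cast
  rfl

/-- Almost surely, the Euler approximations converge to the solution and the reversibility defect
is small compared to the quadratic variation of the noise. -/
lemma ae_eulerApprox (hβ : 0 < β) (hs : IsLangevinSolution β V P W X) (hV : ContDiff ℝ 2 V)
    (T : ℝ≥0) :
    ∀ᵐ ω ∂P,
      Tendsto (fun N => eulerApprox β V W X T N ω (Fin.last N)) atTop (𝓝 (X T ω)) ∧
      ∀ ε : ℝ, 0 < ε → ∀ᶠ N : ℕ in atTop,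
        |pathLogRatio β (T / N) (∇ V) V (eulerApprox β V W X T N ω)| ≤
          ε * (1 + ∑ k, ‖brownianNoise β W T N ω k‖ ^ 2) := by
  have hb := contDiff_gradient hV
  filter_upwards [hs.continuous_paths, hs.equation] with ω hc he
  have hζ : ∀ N, brownianNoise β W T N ω = fun k : Fin N =>
      (fun t => √(2 / β) • W t ω) ((k + 1 : ℕ) * (T / N)) -
        (fun t => √(2 / β) • W t ω) ((k : ℕ) * (T / N)) := fun N => by
    ext1 k
    simp only [brownianNoise, smul_sub]
  constructor
  · obtain ⟨R, hR⟩ := eulerPath_tendsto hb.continuous (norm_sub_le_of_contDiff hb) hc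
      (w := fun t => √(2 / β) • W t ω) he T
    rw [Metric.tendsto_atTop']
    intro ε hε
    obtain ⟨N₀, hN₀⟩ := eventually_atTop.1 (hR (ε / 2) (by positivity))
    refine ⟨N₀, fun N hN => ?_⟩
    have := (hN₀ N hN.le).2.2
    rw [dist_eq_norm, eulerApprox, hζ]
    linarith
  · intro ε hε
    have := eventually_abs_pathLogRatio_le hβ hb
      (fun z => inner_gradient ((hV.differentiable (by norm_num)) z)) hc
      (w := fun t => √(2 / β) • W t ω) he T hε
    simp only [eulerApprox, hζ]
    exact this

lemma one_sub_min_exp_le (s : ℝ) : 1 - min 1 (Real.exp s) ≤ |s| := by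
  rcases min_cases 1 (Real.exp s) with h | h
  · rw [h.1]; simp
  · rw [h.1]
    have := Real.add_one_le_exp s
    have := neg_abs_le s
    linarith

lemma reversalWeight_le_one {h : ℝ} {b : EuclideanSpace ℝ (Fin n) → EuclideanSpace ℝ (Fin n)}
    {N : ℕ} (y : Fin (N + 1) → EuclideanSpace ℝ (Fin n)) : reversalWeight β h b V y ≤ 1 :=
  min_le_left _ _

/-- The reversal weights tend to `1` in mean. -/
lemma tendsto_lintegral_one_sub_weight (hβ : 0 < β) (hs : IsLangevinSolution β V P W X)
    (hV : ContDiff ℝ 2 V) (T : ℝ≥0) :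
    Tendsto (fun N : ℕ => ∫⁻ ω, ENNReal.ofReal
      (1 - reversalWeight β (T / N) (∇ V) V (eulerApprox β V W X T N ω)) ∂P) atTop (𝓝 0) := by
  have := hs.isProbabilityMeasure
  have hb : Measurable (∇ V) := (contDiff_gradient hV).continuous.measurable
  have hVm := hV.continuous.measurable
  rw [ENNReal.tendsto_nhds_zero]
  intro η hη
  obtain ⟨r, hr0, hrη⟩ := ENNReal.lt_iff_exists_nnreal_btwn.1 hη
  have hr0' : 0 < r := by exact_mod_cast hr0
  set C : ℝ≥0 := 1 + n * noiseVar β T with hC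
  have hC0 : 0 < C := by positivity
  set ε : ℝ≥0 := r / (2 * C) with hε
  have hε0 : 0 < ε := by positivity
  -- the exceptional event has vanishing probability
  let B : ℕ → Set Ω := fun N =>
    {ω | ¬ |pathLogRatio β (T / N) (∇ V) V (eulerApprox β V W X T N ω)| ≤
    ε * (1 + ∑ k, ‖brownianNoise β W T N ω k‖ ^ 2)}
  have hBm : ∀ N, MeasurableSet (B N) := fun N => by
    have h1 : Measurable fun ω => |pathLogRatio β (T / N) (∇ V) V (eulerApprox β V W X T N ω)| :=
      (continuous_abs.measurable.comp (measurable_pathLogRatio hb hVm N)).comp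
        (measurable_eulerApprox hs hV T N)
    have hζ := measurable_brownianNoise (β := β) hs.isBrownianVec.measurable T N
    have h2 : Measurable fun ω => (ε : ℝ) * (1 + ∑ k, ‖brownianNoise β W T N ω k‖ ^ 2) := by
      fun_prop
    exact (measurableSet_le h1 h2).compl
  have hB : Tendsto (fun N => P (B N)) atTop (𝓝 0) := by
    have h1 : Tendsto (fun N => ∫⁻ ω, (B N).indicator (fun _ => (1 : ℝ≥0∞)) ω ∂P) atTop
        (𝓝 (∫⁻ _, 0 ∂P)) := by
      refine tendsto_lintegral_of_dominated_convergence (fun _ => 1)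
        (fun N => measurable_const.indicator (hBm N))
        (fun N => ae_of_all _ fun ω => indicator_le_self' (fun _ _ => zero_le) ω) (by simp) ?_
      filter_upwards [ae_eulerApprox hβ hs hV T] with ω hω
      refine tendsto_const_nhds.congr' ?_
      filter_upwards [hω.2 ε hε0] with N hN
      exact (indicator_of_notMem (by simpa [B] using hN) _).symm
    simpa [lintegral_indicator_const, hBm] using h1
  have hr2 : (0 : ℝ≥0∞) < (r / 2 : ℝ≥0) := by exact_mod_cast (by positivity : 0 < r / 2)
  filter_upwards [hB.eventually_lt_const hr2, eventually_ne_atTop 0] with N hN hN0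
  have hζ := measurable_brownianNoise (β := β) hs.isBrownianVec.measurable T N
  calc _ ≤ ∫⁻ ω, ((B N).indicator (fun _ => (1 : ℝ≥0∞)) ω +
        ε * (1 + ENNReal.ofReal (∑ k, ‖brownianNoise β W T N ω k‖ ^ 2))) ∂P := by
        refine lintegral_mono fun ω => ?_
        by_cases hω : ω ∈ B N
        · rw [indicator_of_mem hω]
          refine le_add_right ?_
          rw [← ENNReal.ofReal_one]
          refine ENNReal.ofReal_le_ofReal ?_
          have : 0 ≤ reversalWeight β (T / N) (∇ V) V (eulerApprox β V W X T N ω) := by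
            unfold reversalWeight; positivity
          linarith
        · refine le_add_left ?_
          have h1 := one_sub_min_exp_le
            (pathLogRatio β (T / N) (∇ V) V (eulerApprox β V W X T N ω))
          have h2 : |pathLogRatio β (T / N) (∇ V) V (eulerApprox β V W X T N ω)| ≤
            ε * (1 + ∑ k, ‖brownianNoise β W T N ω k‖ ^ 2) := by simpa [B] using hω
          refine (ENNReal.ofReal_le_ofReal (h1.trans h2)).trans_eq ?_
          rw [ENNReal.ofReal_mul (NNReal.coe_nonneg ε), ENNReal.ofReal_add zero_le_one
            (Finset.sum_nonneg fun k _ => sq_nonneg _)]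
          simp
    _ = P (B N) + ε * C := by
        rw [lintegral_add_left (measurable_const.indicator (hBm N)),
          lintegral_const_mul _ (by fun_prop), lintegral_add_left measurable_const,
          lintegral_sum_brownianNoise_sq hs T hN0]
        simp [hBm, hC]
    _ ≤ (r / 2 : ℝ≥0) + (r / 2 : ℝ≥0) := by
        refine add_le_add hN.le ?_
        rw [← ENNReal.coe_mul, ENNReal.coe_le_coe, hε]
        apply le_of_eq
        field_simp
    _ = r := by rw [← ENNReal.coe_add, add_halves]
    _ ≤ η := hrη.le

/-- The symmetrized Euler operators converge to the transition operator of the diffusion. -/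
theorem tendsto_lintegral_symmetrizedEuler (hβ : 0 < β) (hs : IsLangevinSolution β V P W X)
    (hV : ContDiff ℝ 2 V) (T : ℝ≥0) (φ : BoundedContinuousFunction (EuclideanSpace ℝ (Fin n)) ℝ≥0) :
    Tendsto (fun N : ℕ => ∫⁻ x, symmetrizedEuler β (noiseVar β (T / N)) (T / N) (∇ V) V N
      (fun x => φ x) x ∂(P.map (X 0))) atTop (𝓝 (∫⁻ ω, φ (X T ω) ∂P)) := by
  have := hs.isProbabilityMeasure
  have hb : Measurable (∇ V) := (contDiff_gradient hV).continuous.measurable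
  have hVm := hV.continuous.measurable
  have hφm : Measurable fun x => (φ x : ℝ≥0∞) := by
    have := φ.continuous.measurable
    fun_prop
  obtain ⟨M, hM⟩ : ∃ M : ℝ≥0, ∀ x, φ x ≤ M :=
    ⟨nndist φ 0, BoundedContinuousFunction.NNReal.upper_bound φ⟩
  let y : ∀ N, Ω → EuclideanSpace ℝ (Fin n) := fun N ω => eulerApprox β V W X T N ω (Fin.last N)
  let a : ℕ → Ω → ℝ := fun N ω => reversalWeight β (T / N) (∇ V) V (eulerApprox β V W X T N ω)
  have hym : ∀ N, Measurable (y N) := fun N =>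
    (measurable_pi_apply (Fin.last N)).comp (measurable_eulerApprox hs hV T N)
  have ham : ∀ N, Measurable (a N) := fun N =>
    (measurable_reversalWeight hb hVm N).comp (measurable_eulerApprox hs hV T N)
  have hfin : ∀ f : Ω → EuclideanSpace ℝ (Fin n), ∫⁻ ω, φ (f ω) ∂P ≤ M := fun f => by
    calc _ ≤ ∫⁻ _, (M : ℝ≥0∞) ∂P := lintegral_mono fun ω => ENNReal.coe_le_coe.2 (hM _)
      _ = M := by simp
  have h1 : ∀ N : ℕ, ∫⁻ x, symmetrizedEuler β (noiseVar β (T / N)) (T / N) (∇ V) V N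
      (fun x => φ x) x ∂(P.map (X 0)) = ∫⁻ ω, φ (y N ω) * ENNReal.ofReal (a N ω) ∂P := by
    intro N
    have hw := measurable_reversalWeight (β := β) (h := T / N) hb hVm N
    exact (lintegral_eulerApprox hs hV T N
      (F := fun y => φ (y (Fin.last N)) * ENNReal.ofReal (reversalWeight β (T / N) (∇ V) V y))
      ((hφm.comp (g := fun x => (φ x : ℝ≥0∞)) (f := fun y : Fin (N + 1) → EuclideanSpace ℝ (Fin n)
        => y (Fin.last N)) (by fun_prop)).mul hw.ennreal_ofReal)).symm
  have h2 : Tendsto (fun N => ∫⁻ ω, φ (y N ω) ∂P) atTop (𝓝 (∫⁻ ω, φ (X T ω) ∂P)) := by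
    refine tendsto_lintegral_of_dominated_convergence (fun _ => (M : ℝ≥0∞))
      (fun N => hφm.comp (hym N)) (fun N => ae_of_all _ fun ω => ENNReal.coe_le_coe.2 (hM _))
      (by simp) ?_
    filter_upwards [ae_eulerApprox hβ hs hV T] with ω hω
    exact (ENNReal.continuous_coe.comp φ.continuous).continuousAt.tendsto.comp hω.1
  have h3 : Tendsto (fun N => ∫⁻ ω, φ (y N ω) * ENNReal.ofReal (1 - a N ω) ∂P) atTop (𝓝 0) := by
    have h4 := ENNReal.Tendsto.const_mul (a := (M : ℝ≥0∞))
      (tendsto_lintegral_one_sub_weight hβ hs hV T) (Or.inr ENNReal.coe_ne_top)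
    rw [mul_zero] at h4
    refine tendsto_of_tendsto_of_tendsto_of_le_of_le tendsto_const_nhds h4
      (fun N => zero_le) fun N => ?_
    simp only
    rw [← lintegral_const_mul' _ _ ENNReal.coe_ne_top]
    refine lintegral_mono fun ω => ?_
    have := hM (y N ω)
    gcongr
  have h5 := ENNReal.Tendsto.sub h2 h3 (Or.inr ENNReal.zero_ne_top)
  rw [tsub_zero] at h5
  refine h5.congr fun N => ?_
  rw [h1]
  have hsum : ∫⁻ ω, φ (y N ω) ∂P = ∫⁻ ω, φ (y N ω) * ENNReal.ofReal (a N ω) ∂P +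
      ∫⁻ ω, φ (y N ω) * ENNReal.ofReal (1 - a N ω) ∂P := by
    rw [← lintegral_add_left (f := fun ω => φ (y N ω) * ENNReal.ofReal (a N ω))
      ((hφm.comp (hym N)).mul (ham N).ennreal_ofReal)]
    refine lintegral_congr fun ω => ?_
    have h0 : 0 ≤ a N ω := by simp only [a, reversalWeight]; positivity
    have h1 : a N ω ≤ 1 := reversalWeight_le_one _
    rw [← mul_add, ← ENNReal.ofReal_add h0 (by linarith)]
    simp
  rw [hsum]
  refine ENNReal.add_sub_cancel_right (ne_top_of_le_ne_top ?_ (le_add_left le_rfl |>.trans hsum.ge))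
  exact ne_top_of_le_ne_top ENNReal.coe_ne_top (hfin _)

end Convergence

/-! ### Radial potentials: invariance of the coarse-grained measure -/

section Radial

variable {n : ℕ} {β : ℝ} {Vt : ℝ → ℝ} {V : EuclideanSpace ℝ (Fin n) → ℝ}

lemma gradient_comp_isometry (hV : Differentiable ℝ V)
    (U : EuclideanSpace ℝ (Fin n) ≃ₗᵢ[ℝ] EuclideanSpace ℝ (Fin n)) (hVU : ∀ x, V (U x) = V x)
    (x : EuclideanSpace ℝ (Fin n)) : (∇ V) (U x) = U ((∇ V) x) := by
  have h1 : HasFDerivAt V ((innerSL ℝ ((∇ V) (U x))).comp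
      (U : EuclideanSpace ℝ (Fin n) →L[ℝ] EuclideanSpace ℝ (Fin n))) x := by
    have := (inner_gradient (hV (U x))).comp x U.toContinuousLinearEquiv.hasFDerivAt
    have h2 : V ∘ U = V := funext hVU
    simpa [h2, Function.comp_def, hVU] using this
  have h2 := h1.unique (inner_gradient (hV x))
  refine ext_inner_right ℝ fun z => ?_
  have h3 := congrArg (fun L => L (U.symm z)) h2
  simp only [ContinuousLinearMap.comp_apply, innerSL_apply_apply] at h3
  rw [← U.apply_symm_apply z, U.inner_map_map]
  simpa using h3

/-- The first coordinate vector. -/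
noncomputable def unitVec (hn : 1 ≤ n) : EuclideanSpace ℝ (Fin n) := EuclideanSpace.single ⟨0, hn⟩ 1

lemma norm_unitVec (hn : 1 ≤ n) : ‖unitVec hn‖ = 1 := by simp [unitVec]

/-- The action of the symmetrized Euler operator on radial functions. -/
noncomputable def radialEuler (hn : 1 ≤ n) (β : ℝ) (V : EuclideanSpace ℝ (Fin n) → ℝ) (T : ℝ≥0)
    (N : ℕ) (f : ℝ → ℝ≥0∞) (r : ℝ) : ℝ≥0∞ :=
  symmetrizedEuler β (noiseVar β (T / N)) (T / N) (∇ V) V N (fun x => f ‖x‖) (r • unitVec hn)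

lemma measurable_radialEuler (hn : 1 ≤ n) (hV : ContDiff ℝ 2 V) (T : ℝ≥0) (N : ℕ)
    {f : ℝ → ℝ≥0∞} (hf : Measurable f) : Measurable (radialEuler hn β V T N f) :=
  (measurable_symmetrizedEuler (contDiff_gradient hV).continuous.measurable
    hV.continuous.measurable N (hf.comp measurable_norm)).comp (by fun_prop)

lemma radialEuler_le (hn : 1 ≤ n) (T : ℝ≥0) (N : ℕ) {f : ℝ → ℝ≥0∞} {M : ℝ≥0∞}
    (hf : ∀ r, f r ≤ M) (r : ℝ) : radialEuler hn β V T N f r ≤ M := by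
  unfold radialEuler symmetrizedEuler
  calc _ ≤ ∫⁻ _, M ∂(Measure.pi fun _ : Fin N => isoGaussian n (noiseVar β (T / N))) := by
        refine lintegral_mono fun ζ => ?_
        refine (mul_le_mul' (hf _) (ENNReal.ofReal_le_one.2 (reversalWeight_le_one _))).trans ?_
        simp
    _ = M := by simp

lemma noiseVar_ne_zero {β : ℝ} (hβ : 0 < β) {h : ℝ≥0} (hh : h ≠ 0) : noiseVar β h ≠ 0 := by
  intro h0
  have h1 := mul_noiseVar hβ h
  simp [h0] at h1
  exact hh h1

/-- By rotation invariance the operator maps radial functions to radial functions. -/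
lemma symmetrizedEuler_eq_radialEuler (hn : 1 ≤ n) (hβ : 0 < β) (hVt : ∀ x, V x = Vt ‖x‖)
    (hV : ContDiff ℝ 2 V) {T : ℝ≥0} (hT : T ≠ 0) {N : ℕ} (hN : N ≠ 0) {f : ℝ → ℝ≥0∞}
    (hf : Measurable f) (x : EuclideanSpace ℝ (Fin n)) :
    symmetrizedEuler β (noiseVar β (T / N)) (T / N) (∇ V) V N (fun x => f ‖x‖) x =
      radialEuler hn β V T N f ‖x‖ := by
  have hnorm : ‖‖x‖ • unitVec hn‖ = ‖x‖ := by simp [norm_smul, norm_unitVec]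
  let U := (ℝ ∙ (‖x‖ • unitVec hn - x))ᗮ.reflection
  have hU : U (‖x‖ • unitVec hn) = x := Submodule.reflection_sub hnorm
  have hVU : ∀ z, V (U z) = V z := fun z => by rw [hVt, hVt, U.norm_map]
  have hTN : T / N ≠ 0 := div_ne_zero hT (by exact_mod_cast hN)
  have h1 := symmetrizedEuler_comp_isometry (β := β) (h := T / N) (noiseVar_ne_zero hβ hTN)
    (contDiff_gradient hV).continuous.measurable hV.continuous.measurable U
    (gradient_comp_isometry (hV.differentiable (by norm_num)) U hVU) hVU N
    (hf.comp measurable_norm) (fun z => by simp) (‖x‖ • unitVec hn)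
  rw [hU] at h1
  exact h1

/-- The radial operator is symmetric for the coarse-grained measure. -/
lemma lintegral_radialEuler_comm (hn : 1 ≤ n) (hβ : 0 < β) (hVt : ∀ x, V x = Vt ‖x‖)
    (hV : ContDiff ℝ 2 V) {T : ℝ≥0} (hT : T ≠ 0) {N : ℕ} (hN : N ≠ 0) {f g : ℝ → ℝ≥0∞}
    (hf : Measurable f) (hg : Measurable g) :
    ∫⁻ r, f r * radialEuler hn β V T N g r ∂(radialMeasure β V) =
      ∫⁻ r, g r * radialEuler hn β V T N f r ∂(radialMeasure β V) := by
  have hT0 : (0 : ℝ) < T / N := by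
    have : 0 < T := pos_of_ne_zero hT
    have : 0 < N := Nat.pos_of_ne_zero hN
    positivity
  have hvar : β * noiseVar β (T / N) = 2 * ((T : ℝ) / N) := by
    rw [mul_noiseVar hβ]; push_cast; rfl
  have h1 := lintegral_symmetrizedEuler_comm hT0 hβ hvar
    (contDiff_gradient hV).continuous.measurable hV.continuous.measurable N
    (hf.comp measurable_norm) (hg.comp measurable_norm)
  simp only [Function.comp_def, symmetrizedEuler_eq_radialEuler hn hβ hVt hV hT hN hf,
    symmetrizedEuler_eq_radialEuler hn hβ hVt hV hT hN hg] at h1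
  have hf' := measurable_radialEuler (β := β) hn hV T N hf
  have hg' := measurable_radialEuler (β := β) hn hV T N hg
  rw [radialMeasure, lintegral_map (by fun_prop) measurable_norm,
    lintegral_map (by fun_prop) measurable_norm]
  exact h1

variable {Ω : Type u} [MeasurableSpace Ω] {P : Measure Ω}
  {W X : ℝ≥0 → Ω → EuclideanSpace ℝ (Fin n)}

lemma measurable_coe_bcf (φ : BoundedContinuousFunction ℝ ℝ≥0) :
    Measurable fun r => (φ r : ℝ≥0∞) := by
  have := φ.continuous.measurable
  fun_prop

lemma tendsto_lintegral_radialEuler (hn : 1 ≤ n) (hβ : 0 < β) (hVt : ∀ x, V x = Vt ‖x‖)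
    (hV : ContDiff ℝ 2 V) (hs : IsLangevinSolution β V P W X) {T : ℝ≥0} (hT : T ≠ 0)
    (φ : BoundedContinuousFunction ℝ ℝ≥0) :
    Tendsto (fun N : ℕ => ∫⁻ r, radialEuler hn β V T N (fun r => φ r) r
      ∂(P.map fun ω => ‖X 0 ω‖)) atTop (𝓝 (∫⁻ r, φ r ∂(P.map fun ω => ‖X T ω‖))) := by
  have h1 := tendsto_lintegral_symmetrizedEuler hβ hs hV T
    (φ.compContinuous ⟨fun x => ‖x‖, continuous_norm⟩)
  rw [lintegral_map (measurable_coe_bcf φ) (hs.measurable T).norm]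
  refine h1.congr' ?_
  filter_upwards [eventually_ne_atTop 0] with N hN
  have h2 : P.map (fun ω => ‖X 0 ω‖) = (P.map (X 0)).map fun x => ‖x‖ := by
    rw [Measure.map_map measurable_norm (hs.measurable 0)]
    rfl
  rw [h2, lintegral_map (measurable_radialEuler hn hV T N (measurable_coe_bcf φ)) measurable_norm]
  refine lintegral_congr fun x => ?_
  exact symmetrizedEuler_eq_radialEuler hn hβ hVt hV hT hN (measurable_coe_bcf φ) x

/-- A solution whose radial part starts from a multiple of the coarse-grained measure keeps that
law. Global existence of this one solution is enough: it forces the weights to tend to `1` in mean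
under the initial law. -/
theorem map_norm_eq_of_initial (hn : 1 ≤ n) (hβ : 0 < β) (hVt : ∀ x, V x = Vt ‖x‖)
    (hV : ContDiff ℝ 2 V) (hs : IsLangevinSolution β V P W X) {c : ℝ≥0∞}
    (h0 : P.map (fun ω => ‖X 0 ω‖) = c • radialMeasure β V) (T : ℝ≥0) :
    P.map (fun ω => ‖X T ω‖) = c • radialMeasure β V := by
  rcases eq_or_ne T 0 with rfl | hT
  · exact h0
  have := hs.isProbabilityMeasure
  have hp0 : IsProbabilityMeasure (P.map fun ω => ‖X 0 ω‖) :=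
    Measure.isProbabilityMeasure_map (hs.measurable 0).norm.aemeasurable
  have hpT : IsProbabilityMeasure (P.map fun ω => ‖X T ω‖) :=
    Measure.isProbabilityMeasure_map (hs.measurable T).norm.aemeasurable
  rw [← h0]
  set ρ := P.map fun ω => ‖X 0 ω‖ with hρ
  refine ext_of_forall_lintegral_eq_of_IsFiniteMeasure fun φ => ?_
  obtain ⟨M, hM⟩ : ∃ M : ℝ≥0, ∀ x, φ x ≤ M :=
    ⟨nndist φ 0, BoundedContinuousFunction.NNReal.upper_bound φ⟩
  have hφm := measurable_coe_bcf φ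
  -- the mean weight of the paths that start at radius `r`
  let one : ℕ → ℝ → ℝ≥0∞ := fun N => radialEuler hn β V T N fun _ => 1
  have hone_m : ∀ N, Measurable (one N) := fun N =>
    measurable_radialEuler hn hV T N measurable_const
  have hone_le : ∀ N r, one N r ≤ 1 := fun N => radialEuler_le hn T N fun _ => le_rfl
  have hone : Tendsto (fun N => ∫⁻ r, one N r ∂ρ) atTop (𝓝 1) := by
    have := tendsto_lintegral_radialEuler hn hβ hVt hV hs hT
      (BoundedContinuousFunction.const ℝ (1 : ℝ≥0))
    simpa using this
  -- `φ` is bounded and the mean weights tend to `1` in `L¹(ρ)`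
  have hlim : Tendsto (fun N => ∫⁻ r, φ r * one N r ∂ρ) atTop (𝓝 (∫⁻ r, φ r ∂ρ)) := by
    have hdef : Tendsto (fun N => ∫⁻ r, φ r ∂ρ - M * (1 - ∫⁻ r, one N r ∂ρ)) atTop
        (𝓝 (∫⁻ r, φ r ∂ρ)) := by
      have h1 := ENNReal.Tendsto.sub (tendsto_const_nhds (x := (1 : ℝ≥0∞))) hone
        (Or.inl ENNReal.one_ne_top)
      have h2 := ENNReal.Tendsto.const_mul (a := (M : ℝ≥0∞)) h1 (Or.inr ENNReal.coe_ne_top)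
      have h3 := ENNReal.Tendsto.sub (tendsto_const_nhds (x := ∫⁻ r, (φ r : ℝ≥0∞) ∂ρ)) h2
        (Or.inr (by simp))
      simpa using h3
    refine tendsto_of_tendsto_of_tendsto_of_le_of_le hdef tendsto_const_nhds (fun N => ?_)
      fun N => lintegral_mono fun r => mul_le_of_le_one_right' (hone_le N r)
    simp only
    rw [tsub_le_iff_right]
    have h1 : 1 - ∫⁻ r, one N r ∂ρ = ∫⁻ r, (1 - one N r) ∂ρ := by
      rw [lintegral_sub (hone_m N) (ne_top_of_le_ne_top ENNReal.one_ne_top (by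
        calc ∫⁻ r, one N r ∂ρ ≤ ∫⁻ _, 1 ∂ρ := lintegral_mono (hone_le N)
          _ = 1 := by simp)) (ae_of_all _ (hone_le N))]
      simp
    rw [h1, ← lintegral_const_mul _ (by fun_prop), ← lintegral_add_left (by fun_prop)]
    refine lintegral_mono fun r => ?_
    calc (φ r : ℝ≥0∞) = φ r * (one N r + (1 - one N r)) := by
          rw [add_tsub_cancel_of_le (hone_le N r), mul_one]
      _ = φ r * one N r + φ r * (1 - one N r) := mul_add _ _ _
      _ ≤ _ := by
          have := hM r
          gcongr
  refine tendsto_nhds_unique (tendsto_lintegral_radialEuler hn hβ hVt hV hs hT φ) (hlim.congr' ?_)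
  filter_upwards [eventually_ne_atTop 0] with N hN
  -- symmetry moves the operator from `φ` to the constant `1`
  have h1 := lintegral_radialEuler_comm hn hβ hVt hV hT hN hφm
    (measurable_const (a := (1 : ℝ≥0∞)))
  rw [← hρ, h0, lintegral_smul_measure, lintegral_smul_measure, h1]
  simp

/-- A family of probability measures that integrates bounded continuous functions measurably is
measurable. -/
lemma measurable_of_measurable_lintegral {κ : ℝ → Measure ℝ} [∀ r, IsProbabilityMeasure (κ r)]
    (h : ∀ φ : BoundedContinuousFunction ℝ ℝ≥0, Measurable fun r => ∫⁻ s, φ s ∂(κ r)) :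
    Measurable κ := by
  refine Measurable.measure_of_isPiSystem_of_isProbabilityMeasure (S := {F | IsClosed F})
    (by rw [BorelSpace.measurable_eq (α := ℝ), borel_eq_generateFrom_isClosed])
    isPiSystem_isClosed fun F hF => ?_
  exact ENNReal.measurable_of_tendsto (fun k => h (hF.apprSeq k))
    (tendsto_pi_nhds.2 fun r => HasOuterApproxClosed.tendsto_lintegral_apprSeq hF (κ r))

lemma isLocallyFiniteMeasure_gibbsMeasure (hV : Continuous V) :
    IsLocallyFiniteMeasure (gibbsMeasure β V) :=
  IsLocallyFiniteMeasure.withDensity_ofReal (by fun_prop)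

lemma isFiniteMeasureOnCompacts_radialMeasure (hV : Continuous V) :
    IsFiniteMeasureOnCompacts (radialMeasure β V) := by
  have := isLocallyFiniteMeasure_gibbsMeasure (β := β) hV
  refine ⟨fun K hK => ?_⟩
  obtain ⟨R, hR⟩ := hK.isBounded.subset_closedBall 0
  rw [radialMeasure, Measure.map_apply measurable_norm hK.measurableSet]
  refine lt_of_le_of_lt (measure_mono fun x hx => ?_)
    (isCompact_closedBall (0 : EuclideanSpace ℝ (Fin n)) R).measure_lt_top
  have := hR hx
  simpa using this

/-- Continuous cutoff functions with compact support that increase to `1`. -/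
noncomputable def cutoff (k : ℕ) : CompactlySupportedContinuousMap ℝ ℝ≥0 where
  toFun r := Real.toNNReal (min 1 (k - |r|))
  continuous_toFun := by fun_prop
  hasCompactSupport' := HasCompactSupport.intro (isCompact_closedBall (0 : ℝ) k) fun r h => by
    simp only [Metric.mem_closedBall, dist_zero_right, Real.norm_eq_abs, not_le] at h
    exact Real.toNNReal_of_nonpos ((min_le_right _ _).trans (by linarith))

lemma cutoff_apply (k : ℕ) (r : ℝ) : cutoff k r = Real.toNNReal (min 1 (k - |r|)) := rfl

lemma monotone_cutoff (r : ℝ) : Monotone fun k => cutoff k r := fun a b hab => by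
  have : (a : ℝ) ≤ b := by exact_mod_cast hab
  simp only [cutoff_apply]
  exact Real.toNNReal_le_toNNReal (min_le_min_left _ (by linarith))

lemma tendsto_cutoff (r : ℝ) : Tendsto (fun k : ℕ => (cutoff k r : ℝ≥0∞)) atTop (𝓝 1) := by
  refine tendsto_const_nhds.congr' ?_
  filter_upwards [eventually_ge_atTop ⌈1 + |r|⌉₊] with k hk
  have : 1 + |r| ≤ k := Nat.ceil_le.1 hk
  rw [cutoff_apply, min_eq_left (by linarith), Real.toNNReal_one, ENNReal.coe_one]

lemma lintegral_lt_top_of_compactSupport {ν : Measure ℝ} [IsFiniteMeasureOnCompacts ν]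
    (f : CompactlySupportedContinuousMap ℝ ℝ≥0) : ∫⁻ r, f r ∂ν < ⊤ := by
  have h1 : Integrable (fun r => (f r : ℝ)) ν :=
    Continuous.integrable_of_hasCompactSupport (by fun_prop)
      (f.hasCompactSupport.comp_left rfl)
  have h2 := h1.lintegral_lt_top
  simpa using h2

/-- Measures on the line that are finite on compact sets are determined by their integrals of
nonnegative continuous functions with compact support; finiteness is needed only for one of them. -/
lemma ext_of_lintegral_compactSupport {ν ν' : Measure ℝ} [IsFiniteMeasureOnCompacts ν]
    (h : ∀ f : CompactlySupportedContinuousMap ℝ ℝ≥0, ∫⁻ r, f r ∂ν' = ∫⁻ r, f r ∂ν) : ν' = ν := by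
  have hfin : IsFiniteMeasureOnCompacts ν' := by
    refine ⟨fun K hK => ?_⟩
    obtain ⟨R, hR⟩ := hK.isBounded.subset_closedBall 0
    obtain ⟨k, hk⟩ := exists_nat_ge (R + 1)
    have h1 : ∀ r ∈ K, cutoff k r = 1 := fun r hr => by
      have := hR hr
      simp only [Metric.mem_closedBall, dist_zero_right, Real.norm_eq_abs] at this
      rw [cutoff_apply, min_eq_left (by linarith), Real.toNNReal_one]
    calc ν' K = ∫⁻ r in K, cutoff k r ∂ν' := by
          rw [setLIntegral_congr_fun hK.measurableSet fun r hr => by rw [h1 r hr]]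
          simp
      _ ≤ ∫⁻ r, cutoff k r ∂ν' := setLIntegral_le_lintegral _ _
      _ < ⊤ := by
          rw [h]
          exact lintegral_lt_top_of_compactSupport _
  refine Measure.ext_of_integral_eq_on_compactlySupported_nnreal fun f => ?_
  have hc : Continuous f := f.continuous
  rw [integral_eq_lintegral_of_nonneg_ae (ae_of_all _ fun _ => NNReal.coe_nonneg _)
    (by fun_prop), integral_eq_lintegral_of_nonneg_ae (ae_of_all _ fun _ => NNReal.coe_nonneg _)
    (by fun_prop)]
  simp only [ENNReal.ofReal_coe_nnreal, h]

/-- Without explosion, the radial part has transition kernels: the limits of the radial Euler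
operators. -/
theorem exists_kernel_tendsto_radialEuler (hn : 1 ≤ n) (hβ : 0 < β) (hV : ContDiff ℝ 2 V)
    (hwp : LangevinWellPosed.{u} β V) (T : ℝ≥0) :
    ∃ κ : Kernel ℝ ℝ, IsMarkovKernel κ ∧ ∀ (φ : BoundedContinuousFunction ℝ ℝ≥0) (r : ℝ),
      Tendsto (fun N : ℕ => radialEuler hn β V T N (fun s => φ s) r) atTop
        (𝓝 (∫⁻ s, φ s ∂(κ r))) := by
  have hx : ∀ r : ℝ, ∃ ρ : Measure ℝ, IsProbabilityMeasure ρ ∧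
      ∀ φ : BoundedContinuousFunction ℝ ℝ≥0,
        Tendsto (fun N : ℕ => radialEuler hn β V T N (fun s => φ s) r) atTop
          (𝓝 (∫⁻ s, φ s ∂ρ)) := by
    intro r
    obtain ⟨Ω, mΩ, P, W, X, hs, h0⟩ := hwp (r • unitVec hn)
    have := hs.isProbabilityMeasure
    refine ⟨P.map fun ω => ‖X T ω‖,
      Measure.isProbabilityMeasure_map (hs.measurable T).norm.aemeasurable, fun φ => ?_⟩
    have h1 := tendsto_lintegral_symmetrizedEuler hβ hs hV T
      (φ.compContinuous ⟨fun x => ‖x‖, continuous_norm⟩)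
    have h2 : P.map (X 0) = Measure.dirac (r • unitVec hn) := by
      rw [Measure.map_congr h0, Measure.map_const]
      simp
    rw [lintegral_map (measurable_coe_bcf φ) (hs.measurable T).norm]
    refine h1.congr fun N => ?_
    rw [h2, lintegral_dirac]
    rfl
  choose ρ hρ hlim using hx
  have hm : Measurable ρ := measurable_of_measurable_lintegral fun φ =>
    ENNReal.measurable_of_tendsto
      (fun N => measurable_radialEuler hn hV T N (measurable_coe_bcf φ))
      (tendsto_pi_nhds.2 fun r => hlim r φ)
  exact ⟨⟨ρ, hm⟩, ⟨hρ⟩, fun φ r => hlim r φ⟩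

/-- The limiting kernel transports the law of the radial part of every solution. -/
lemma map_norm_eq_bind (hn : 1 ≤ n) (hβ : 0 < β) (hVt : ∀ x, V x = Vt ‖x‖)
    (hV : ContDiff ℝ 2 V) {T : ℝ≥0} (hT : T ≠ 0) {κ : Kernel ℝ ℝ} [IsMarkovKernel κ]
    (hκ : ∀ (φ : BoundedContinuousFunction ℝ ℝ≥0) (r : ℝ),
      Tendsto (fun N : ℕ => radialEuler hn β V T N (fun s => φ s) r) atTop (𝓝 (∫⁻ s, φ s ∂(κ r))))
    (hs : IsLangevinSolution β V P W X) :
    P.map (fun ω => ‖X T ω‖) = (P.map fun ω => ‖X 0 ω‖).bind κ := by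
  have := hs.isProbabilityMeasure
  have hp0 : IsProbabilityMeasure (P.map fun ω => ‖X 0 ω‖) :=
    Measure.isProbabilityMeasure_map (hs.measurable 0).norm.aemeasurable
  have hpT : IsProbabilityMeasure (P.map fun ω => ‖X T ω‖) :=
    Measure.isProbabilityMeasure_map (hs.measurable T).norm.aemeasurable
  refine ext_of_forall_lintegral_eq_of_IsFiniteMeasure fun φ => ?_
  have hφm := measurable_coe_bcf φ
  rw [Measure.lintegral_bind κ.measurable.aemeasurable hφm.aemeasurable]
  refine tendsto_nhds_unique (tendsto_lintegral_radialEuler hn hβ hVt hV hs hT φ) ?_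
  refine tendsto_lintegral_of_dominated_convergence (fun _ => ((nndist φ 0 : ℝ≥0) : ℝ≥0∞))
    (fun N => measurable_radialEuler hn hV T N hφm)
    (fun N => ae_of_all _ fun r => radialEuler_le hn T N (fun s => ENNReal.coe_le_coe.2
      (BoundedContinuousFunction.NNReal.upper_bound φ s)) r) (by simp)
    (ae_of_all _ fun r => hκ φ r)

/-- The limiting kernel is symmetric for the coarse-grained measure and conservative, so it leaves
the measure invariant, even if the total mass is infinite. -/
theorem invariant_of_tendsto_radialEuler (hn : 1 ≤ n) (hβ : 0 < β) (hVt : ∀ x, V x = Vt ‖x‖)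
    (hV : ContDiff ℝ 2 V) {T : ℝ≥0} (hT : T ≠ 0) {κ : Kernel ℝ ℝ} [IsMarkovKernel κ]
    (hκ : ∀ (φ : BoundedContinuousFunction ℝ ℝ≥0) (r : ℝ),
      Tendsto (fun N : ℕ => radialEuler hn β V T N (fun s => φ s) r) atTop
        (𝓝 (∫⁻ s, φ s ∂(κ r)))) :
    (radialMeasure β V).bind κ = radialMeasure β V := by
  have := isFiniteMeasureOnCompacts_radialMeasure (β := β) hV.continuous
  set ν := radialMeasure β V
  have hm : ∀ f : CompactlySupportedContinuousMap ℝ ℝ≥0, Measurable fun r => (f r : ℝ≥0∞) :=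
    fun f => measurable_coe_bcf (f : BoundedContinuousFunction ℝ ℝ≥0)
  have hκm : ∀ f : CompactlySupportedContinuousMap ℝ ℝ≥0,
      Measurable fun r => ∫⁻ s, f s ∂(κ r) := fun f => (hm f).lintegral_kernel
  have hlim : ∀ f g : CompactlySupportedContinuousMap ℝ ℝ≥0,
      Tendsto (fun N : ℕ => ∫⁻ r, f r * radialEuler hn β V T N (fun s => g s) r ∂ν) atTop
        (𝓝 (∫⁻ r, f r * ∫⁻ s, g s ∂(κ r) ∂ν)) := by
    intro f g
    let g' : BoundedContinuousFunction ℝ ℝ≥0 := g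
    have hb := BoundedContinuousFunction.NNReal.upper_bound g'
    refine tendsto_lintegral_of_dominated_convergence
      (fun r => f r * ((nndist g' 0 : ℝ≥0) : ℝ≥0∞))
      (fun N => (hm f).mul (measurable_radialEuler hn hV T N (hm g)))
      (fun N => ae_of_all _ fun r => ?_) ?_ (ae_of_all _ fun r => ?_)
    · exact mul_le_mul_right (radialEuler_le hn T N (fun s => ENNReal.coe_le_coe.2 (hb s)) r) _
    · rw [lintegral_mul_const _ (hm f)]
      exact (ENNReal.mul_lt_top (lintegral_lt_top_of_compactSupport f) ENNReal.coe_lt_top).ne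
    · exact ENNReal.Tendsto.const_mul (hκ g' r) (Or.inr ENNReal.coe_ne_top)
  have hsymm : ∀ f g : CompactlySupportedContinuousMap ℝ ℝ≥0,
      ∫⁻ r, f r * ∫⁻ s, g s ∂(κ r) ∂ν = ∫⁻ r, g r * ∫⁻ s, f s ∂(κ r) ∂ν := by
    intro f g
    refine tendsto_nhds_unique (hlim f g) ((hlim g f).congr' ?_)
    filter_upwards [eventually_ne_atTop 0] with N hN
    exact lintegral_radialEuler_comm hn hβ hVt hV hT hN (hm g) (hm f)
  refine ext_of_lintegral_compactSupport fun f => ?_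
  rw [Measure.lintegral_bind κ.measurable.aemeasurable (hm f).aemeasurable]
  have hmono : ∀ r, Monotone fun k => (cutoff k r : ℝ≥0∞) := fun r a b hab =>
    ENNReal.coe_le_coe.2 (monotone_cutoff r hab)
  -- symmetry tested against `f` and cutoffs that increase to `1`
  have h1 : Tendsto (fun k => ∫⁻ r, cutoff k r * ∫⁻ s, f s ∂(κ r) ∂ν) atTop
      (𝓝 (∫⁻ r, ∫⁻ s, f s ∂(κ r) ∂ν)) := by
    refine lintegral_tendsto_of_tendsto_of_monotone
      (fun k => ((hm (cutoff k)).mul (hκm f)).aemeasurable)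
      (ae_of_all _ fun r a b hab => mul_le_mul_left (hmono r hab) _) (ae_of_all _ fun r => ?_)
    have := ENNReal.Tendsto.mul_const (b := ∫⁻ s, f s ∂(κ r)) (tendsto_cutoff r)
      (Or.inl one_ne_zero)
    simpa using this
  have h2 : Tendsto (fun k => ∫⁻ r, f r * ∫⁻ s, cutoff k s ∂(κ r) ∂ν) atTop
      (𝓝 (∫⁻ r, f r ∂ν)) := by
    refine lintegral_tendsto_of_tendsto_of_monotone
      (fun k => ((hm f).mul (hκm (cutoff k))).aemeasurable)
      (ae_of_all _ fun r a b hab => mul_le_mul_right (lintegral_mono fun s => hmono s hab) _)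
      (ae_of_all _ fun r => ?_)
    have h3 : Tendsto (fun k => ∫⁻ s, cutoff k s ∂(κ r)) atTop (𝓝 (∫⁻ _, 1 ∂(κ r))) :=
      lintegral_tendsto_of_tendsto_of_monotone (fun k => (hm (cutoff k)).aemeasurable)
        (ae_of_all _ fun s => hmono s) (ae_of_all _ tendsto_cutoff)
    have := ENNReal.Tendsto.const_mul (a := (f r : ℝ≥0∞)) h3 (Or.inr ENNReal.coe_ne_top)
    simpa using this
  exact tendsto_nhds_unique h1 (h2.congr fun k => hsymm f (cutoff k))

/-- Existence of transition kernels for the radial part, and invariance. -/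
theorem exists_isRadialTransition (hn : 1 ≤ n) (hβ : 0 < β) (hVt : ∀ x, V x = Vt ‖x‖)
    (hV : ContDiff ℝ 2 V) (hwp : LangevinWellPosed.{u} β V) :
    ∃ κ : ℝ≥0 → Kernel ℝ ℝ, IsRadialTransition.{u} β V κ ∧
      ∀ t, (κ t).Invariant (radialMeasure β V) := by
  have hκ : ∀ T : ℝ≥0, ∃ κ : Kernel ℝ ℝ, IsMarkovKernel κ ∧
      (∀ (Ω : Type u) [MeasurableSpace Ω] (P : Measure Ω)
        (W X : ℝ≥0 → Ω → EuclideanSpace ℝ (Fin n)), IsLangevinSolution β V P W X →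
        P.map (fun ω => ‖X T ω‖) = (P.map fun ω => ‖X 0 ω‖).bind κ) ∧
      κ.Invariant (radialMeasure β V) := by
    intro T
    rcases eq_or_ne T 0 with rfl | hT
    · refine ⟨Kernel.id, inferInstance, fun Ω _ P W X _ => ?_, ?_⟩
      · exact Measure.id_comp.symm
      · exact Measure.id_comp
    · obtain ⟨κ, hM, hκ⟩ := exists_kernel_tendsto_radialEuler hn hβ hV hwp T
      exact ⟨κ, hM, fun Ω _ P W X hs => map_norm_eq_bind hn hβ hVt hV hT hκ hs,
        invariant_of_tendsto_radialEuler hn hβ hVt hV hT hκ⟩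
  choose κ hM hT hI using hκ
  exact ⟨κ, ⟨hM, fun Ω _ P W X hs t => hT t Ω P W X hs⟩, hI⟩

end Radial

/-! ### Polar coordinates and microcanonical measures -/

section Polar

variable {n : ℕ}

/-- The surface measure of the unit sphere. -/
noncomputable abbrev unitSphereMeasure (n : ℕ) :
    Measure (Metric.sphere (0 : EuclideanSpace ℝ (Fin n)) 1) :=
  (volume : Measure (EuclideanSpace ℝ (Fin n))).toSphere

/-- The area of the unit sphere. -/
noncomputable def sphereArea (n : ℕ) : ℝ := (unitSphereMeasure n).real univ

lemma nontrivial_euclidean (hn : 1 ≤ n) : Nontrivial (EuclideanSpace ℝ (Fin n)) :=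
  ⟨unitVec hn, 0, fun h => by simpa [h] using norm_unitVec hn⟩

lemma sphereArea_pos (hn : 1 ≤ n) : 0 < sphereArea n := by
  have := nontrivial_euclidean hn
  have h1 : unitSphereMeasure n ≠ 0 := Measure.toSphere_ne_zero _
  rw [sphereArea, measureReal_def]
  exact ENNReal.toReal_pos (Measure.measure_univ_ne_zero.2 h1) (measure_ne_top _ _)

/-- The measure `r^{n-1} dr` on `(0, ∞)`, as a measure on the line. -/
noncomputable def radialLebesgue (n : ℕ) : Measure ℝ :=
  (volume.restrict (Ioi 0)).withDensity fun r => ENNReal.ofReal (r ^ (n - 1))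

lemma map_volumeIoiPow (m : ℕ) :
    (Measure.volumeIoiPow m).map Subtype.val =
      (volume.restrict (Ioi (0 : ℝ))).withDensity fun r => ENNReal.ofReal (r ^ m) := by
  ext s hs
  rw [Measure.map_apply measurable_subtype_coe hs, Measure.volumeIoiPow, withDensity_apply _
    (measurable_subtype_coe hs), withDensity_apply _ hs, ← map_comap_subtype_coe measurableSet_Ioi,
    setLIntegral_map hs (by fun_prop) measurable_subtype_coe]

instance (n : ℕ) : SFinite (radialLebesgue n) := by unfold radialLebesgue; infer_instance

/-- Polar coordinates: Lebesgue measure is the image of `dσ(u) r^{n-1} dr` under `(u, r) ↦ r u`. -/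
lemma measurePreserving_polar (hn : 1 ≤ n) :
    MeasurePreserving
      (fun p : Metric.sphere (0 : EuclideanSpace ℝ (Fin n)) 1 × ℝ =>
        p.2 • (p.1 : EuclideanSpace ℝ (Fin n)))
      ((unitSphereMeasure n).prod (radialLebesgue n)) volume := by
  have := nontrivial_euclidean hn
  have hm : Measurable fun p : Metric.sphere (0 : EuclideanSpace ℝ (Fin n)) 1 × ℝ =>
      p.2 • (p.1 : EuclideanSpace ℝ (Fin n)) := by fun_prop
  refine ⟨hm, ?_⟩
  have h1 := (Measure.measurePreserving_homeomorphUnitSphereProd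
    (volume : Measure (EuclideanSpace ℝ (Fin n))))
  have h2 := h1.symm (homeomorphUnitSphereProd (EuclideanSpace ℝ (Fin n))).toMeasurableEquiv
  rw [finrank_euclideanSpace_fin] at h2
  have h3 : (volume : Measure (EuclideanSpace ℝ (Fin n))) =
      ((volume : Measure (EuclideanSpace ℝ (Fin n))).comap
        (Subtype.val : ({0}ᶜ : Set (EuclideanSpace ℝ (Fin n))) → _)).map Subtype.val := by
    rw [map_comap_subtype_coe (measurableSet_singleton _).compl,
      Measure.restrict_eq_self_of_ae_mem]
    exact compl_mem_ae_iff.2 (by simp)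
  have h4 : (unitSphereMeasure n).prod (radialLebesgue n) =
      ((unitSphereMeasure n).prod (Measure.volumeIoiPow (n - 1))).map
        (Prod.map id Subtype.val) := by
    rw [← Measure.map_prod_map _ _ measurable_id measurable_subtype_coe, Measure.map_id,
      map_volumeIoiPow]
    rfl
  rw [h4, Measure.map_map hm (by fun_prop)]
  conv_rhs => rw [h3, ← h2.map_eq, Measure.map_map measurable_subtype_coe h2.measurable]
  congr 1

/-- The microcanonical measure of `|x|` at the level `y`: the surface measure of the sphere of
radius `y` (zero for `y ≤ 0`). -/
noncomputable def sphereMeasure (n : ℕ) (y : ℝ) : Measure (EuclideanSpace ℝ (Fin n)) :=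
  if 0 < y then ENNReal.ofReal (y ^ (n - 1)) • (unitSphereMeasure n).map fun u => y • u.1 else 0

instance (n : ℕ) (y : ℝ) : IsFiniteMeasure (sphereMeasure n y) := by
  unfold sphereMeasure
  split_ifs
  · exact Measure.smul_finite _ ENNReal.ofReal_ne_top
  · infer_instance

lemma integral_sphereMeasure {y : ℝ} (hy : 0 < y) {f : EuclideanSpace ℝ (Fin n) → ℝ}
    (hf : Measurable f) :
    ∫ x, f x ∂(sphereMeasure n y) = y ^ (n - 1) * ∫ u, f (y • u.1) ∂(unitSphereMeasure n) := by
  rw [sphereMeasure, if_pos hy, integral_smul_measure,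
    integral_map (by fun_prop) hf.aestronglyMeasurable, ENNReal.toReal_ofReal (by positivity),
    smul_eq_mul]

lemma lintegral_sphereMeasure {y : ℝ} (hy : 0 < y) {f : EuclideanSpace ℝ (Fin n) → ℝ≥0∞}
    (hf : Measurable f) :
    ∫⁻ x, f x ∂(sphereMeasure n y) =
      ENNReal.ofReal (y ^ (n - 1)) * ∫⁻ u, f (y • u.1) ∂(unitSphereMeasure n) := by
  rw [sphereMeasure, if_pos hy, lintegral_smul_measure, lintegral_map hf (by fun_prop), smul_eq_mul]

lemma norm_smul_sphere {y : ℝ} (hy : 0 < y)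
    (u : Metric.sphere (0 : EuclideanSpace ℝ (Fin n)) 1) : ‖y • u.1‖ = y := by
  rw [norm_smul, norm_eq_of_mem_sphere, Real.norm_eq_abs, abs_of_pos hy, mul_one]

lemma lintegral_polar (hn : 1 ≤ n) {f : EuclideanSpace ℝ (Fin n) → ℝ≥0∞} (hf : Measurable f) :
    ∫⁻ x, f x = ∫⁻ r in Ioi (0 : ℝ), ∫⁻ x, f x ∂(sphereMeasure n r) := by
  have hm : Measurable fun p : Metric.sphere (0 : EuclideanSpace ℝ (Fin n)) 1 × ℝ =>
      f (p.2 • p.1.1) := hf.comp (by fun_prop)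
  rw [← (measurePreserving_polar hn).lintegral_comp hf, lintegral_prod_symm _ hm.aemeasurable,
    radialLebesgue, lintegral_withDensity_eq_lintegral_mul _ (by fun_prop)
    hm.lintegral_prod_left']
  refine setLIntegral_congr_fun measurableSet_Ioi fun r hr => ?_
  rw [lintegral_sphereMeasure hr hf]
  rfl

/-- Integration in polar coordinates. -/
lemma integral_polar (hn : 1 ≤ n) {f : EuclideanSpace ℝ (Fin n) → ℝ} (hf : Measurable f)
    (hi : Integrable f) :
    IntegrableOn (fun r => ∫ x, f x ∂(sphereMeasure n r)) (Ioi (0 : ℝ)) ∧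
      ∫ r in Ioi (0 : ℝ), ∫ x, f x ∂(sphereMeasure n r) = ∫ x, f x := by
  have hpol := measurePreserving_polar hn
  have hi' := (hpol.integrable_comp hf.aestronglyMeasurable).2 hi
  have hdens : radialLebesgue n =
      (volume.restrict (Ioi (0 : ℝ))).withDensity fun r => ((r ^ (n - 1)).toNNReal : ℝ≥0∞) := rfl
  have hpow : ∀ r ∈ Ioi (0 : ℝ), (r ^ (n - 1)).toNNReal •
      ∫ u : Metric.sphere (0 : EuclideanSpace ℝ (Fin n)) 1, f (r • u.1) ∂(unitSphereMeasure n) =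
      ∫ x, f x ∂(sphereMeasure n r) := fun r hr => by
    have : (0 : ℝ) ≤ r ^ (n - 1) := pow_nonneg (le_of_lt hr) _
    rw [integral_sphereMeasure hr hf, NNReal.smul_def, Real.coe_toNNReal _ this, smul_eq_mul]
  constructor
  · have h1 := hi'.integral_prod_right
    rw [hdens, integrable_withDensity_iff_integrable_smul (by fun_prop)] at h1
    exact (integrableOn_congr_fun hpow measurableSet_Ioi).1 h1
  · have h1 := integral_map (μ := (unitSphereMeasure n).prod (radialLebesgue n))
      hpol.measurable.aemeasurable (f := f) (by rw [hpol.map_eq]; exact hf.aestronglyMeasurable)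
    have h2 := integral_prod_symm (fun p : Metric.sphere (0 : EuclideanSpace ℝ (Fin n)) 1 × ℝ =>
      f (p.2 • p.1.1)) hi'
    rw [hpol.map_eq, h2, hdens, integral_withDensity_eq_integral_smul (by fun_prop)] at h1
    rw [h1]
    exact (setIntegral_congr_fun measurableSet_Ioi hpow).symm

/-- The surface measures form a microcanonical family. -/
lemma isMicrocanonicalFamily_sphereMeasure (hn : 1 ≤ n) :
    IsMicrocanonicalFamily (fun x : EuclideanSpace ℝ (Fin n) => ‖x‖) (sphereMeasure n) := by
  refine ⟨ae_of_all _ fun a => inferInstance, fun F hF hFc G hG => ?_⟩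
  have hGF : Continuous fun x : EuclideanSpace ℝ (Fin n) => G ‖x‖ * F x := by fun_prop
  have hi : Integrable fun x : EuclideanSpace ℝ (Fin n) => G ‖x‖ * F x :=
    hGF.integrable_of_hasCompactSupport hFc.mul_left
  have hpol := integral_polar hn hGF.measurable hi
  have heq : ∀ r ∈ Ioi (0 : ℝ), ∫ x, G ‖x‖ * F x ∂(sphereMeasure n r) =
      G r * ∫ x, F x ∂(sphereMeasure n r) := fun r hr => by
    rw [integral_sphereMeasure hr hGF.measurable, integral_sphereMeasure hr hF.measurable]
    simp only [norm_smul_sphere hr]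
    rw [integral_const_mul]
    ring
  have hzero : ∀ r ∉ Ioi (0 : ℝ), G r * ∫ x, F x ∂(sphereMeasure n r) = 0 := fun r hr => by
    rw [sphereMeasure, if_neg (by simpa using hr)]
    simp
  rw [integrableOn_congr_fun heq measurableSet_Ioi,
    setIntegral_congr_fun measurableSet_Ioi heq] at hpol
  refine ⟨?_, ?_⟩
  · exact (integrableOn_iff_integrable_of_support_subset fun r hr => by
      by_contra h
      exact hr (hzero r h)).1 hpol.1
  · rw [← hpol.2, setIntegral_eq_integral_of_forall_compl_eq_zero hzero]

/-- The surface measures are the thin-shell limits. -/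
lemma isMicrocanonicalAt_sphereMeasure (hn : 1 ≤ n) {y : ℝ} (hy : 0 < y) :
    IsMicrocanonicalAt (fun x : EuclideanSpace ℝ (Fin n) => ‖x‖) y (sphereMeasure n y) := by
  refine ⟨inferInstance, fun φ hφ hφc => ?_⟩
  set M : ℝ → ℝ := fun r => r ^ (n - 1) * ∫ u, φ (r • u.1) ∂(unitSphereMeasure n) with hM
  have hMc : Continuous M := by
    have h1 : Continuous fun r : ℝ => ∫ u, φ (r • u.1) ∂(unitSphereMeasure n) := by
      have := continuous_parametric_integral_of_continuous (μ := unitSphereMeasure n)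
        (f := fun (r : ℝ) (u : Metric.sphere (0 : EuclideanSpace ℝ (Fin n)) 1) => φ (r • u.1))
        (by fun_prop) isCompact_univ
      simpa using this
    fun_prop
  have hMy : ∫ x, φ x ∂(sphereMeasure n y) = M y := integral_sphereMeasure hy hφ.measurable
  have hder : HasDerivAt (fun s => ∫ r in y..s, M r) (M y) y :=
    intervalIntegral.integral_hasDerivAt_right (hMc.intervalIntegrable _ _)
      (hMc.stronglyMeasurableAtFilter _ _) hMc.continuousAt
  rw [hMy]
  refine hder.tendsto_slope_zero_right.congr' ?_
  filter_upwards [self_mem_nhdsWithin] with h hh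
  have hh : 0 < h := hh
  have hmeas : MeasurableSet {x : EuclideanSpace ℝ (Fin n) | y ≤ ‖x‖ ∧ ‖x‖ < y + h} :=
    (measurableSet_le measurable_const measurable_norm).inter
      (measurableSet_lt measurable_norm measurable_const)
  set S := {x : EuclideanSpace ℝ (Fin n) | y ≤ ‖x‖ ∧ ‖x‖ < y + h} with hS
  have hφi : Integrable φ := hφ.integrable_of_hasCompactSupport hφc
  have hpol := (integral_polar hn (hφ.measurable.indicator hmeas) (hφi.indicator hmeas)).2
  have hval : ∀ r ∈ Ioi (0 : ℝ), ∫ x, S.indicator φ x ∂(sphereMeasure n r) =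
      (Ico y (y + h)).indicator M r := fun r hr => by
    rw [integral_sphereMeasure hr (hφ.measurable.indicator hmeas)]
    by_cases hrI : r ∈ Ico y (y + h)
    · have : ∀ u : Metric.sphere (0 : EuclideanSpace ℝ (Fin n)) 1,
          S.indicator φ (r • u.1) = φ (r • u.1) := fun u =>
        indicator_of_mem (by simpa [hS, norm_smul_sphere hr] using hrI) _
      simp only [this, indicator_of_mem hrI, hM]
    · have : ∀ u : Metric.sphere (0 : EuclideanSpace ℝ (Fin n)) 1,
          S.indicator φ (r • u.1) = 0 := fun u =>
        indicator_of_notMem (by simpa [hS, norm_smul_sphere hr] using hrI) _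
      simp [this, indicator_of_notMem hrI]
  have hsub : Ioi (0 : ℝ) ∩ Ico y (y + h) = Ico y (y + h) :=
    inter_eq_self_of_subset_right fun r hr => lt_of_lt_of_le hy hr.1
  rw [setIntegral_congr_fun measurableSet_Ioi hval, integral_indicator hmeas,
    setIntegral_indicator measurableSet_Ico, hsub] at hpol
  rw [← hpol, intervalIntegral.integral_same, sub_zero, smul_eq_mul,
    intervalIntegral.integral_of_le (by linarith), integral_Ico_eq_integral_Ioc]

end Polar

/-! ### The free energy -/

section FreeEnergy

variable {n : ℕ} {β : ℝ} {Vt : ℝ → ℝ} {V : EuclideanSpace ℝ (Fin n) → ℝ}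

/-- The free energy `Ṽ(y) - S_n(y) / β`. The profile is read off along a coordinate axis, which
makes the function measurable also where `y ≤ 0`. -/
noncomputable def freeEnergy (hn : 1 ≤ n) (β : ℝ) (V : EuclideanSpace ℝ (Fin n) → ℝ) (y : ℝ) : ℝ :=
  V (y • unitVec hn) - 1 / β * radialEntropy n y

lemma measurable_freeEnergy (hn : 1 ≤ n) (hV : Continuous V) :
    Measurable (freeEnergy hn β V) := by
  unfold freeEnergy radialEntropy
  exact (Continuous.measurable (by fun_prop)).sub (by fun_prop)

lemma freeEnergy_of_pos (hn : 1 ≤ n) (hVt : ∀ x, V x = Vt ‖x‖) {y : ℝ} (hy : 0 < y) :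
    freeEnergy hn β V y = Vt y - 1 / β * radialEntropy n y := by
  rw [freeEnergy, hVt, norm_smul, norm_unitVec, mul_one, Real.norm_eq_abs, abs_of_pos hy]

lemma exp_freeEnergy (hn : 1 ≤ n) (hβ : 0 < β) (hVt : ∀ x, V x = Vt ‖x‖) {y : ℝ} (hy : 0 < y) :
    Real.exp (-β * freeEnergy hn β V y) = y ^ (n - 1) * Real.exp (-β * Vt y) := by
  have h1 : -β * freeEnergy hn β V y = Real.log y * ((n - 1 : ℕ) : ℝ) + -β * Vt y := by
    rw [freeEnergy_of_pos hn hVt hy, radialEntropy, Nat.cast_sub hn, Nat.cast_one]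
    field_simp
    ring
  rw [h1, Real.exp_add, mul_comm (Real.log y), Real.exp_nat_mul, Real.exp_log hy]

lemma lintegral_exp_sphereMeasure (hn : 1 ≤ n) (hβ : 0 < β) (hVt : ∀ x, V x = Vt ‖x‖)
    (hV : Continuous V) {y : ℝ} (hy : 0 < y) :
    ∫⁻ x, ENNReal.ofReal (Real.exp (-β * V x)) ∂(sphereMeasure n y) =
      ENNReal.ofReal (sphereArea n * Real.exp (-β * freeEnergy hn β V y)) := by
  rw [lintegral_sphereMeasure hy (by fun_prop)]
  simp only [hVt, norm_smul_sphere hy, lintegral_const]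
  rw [exp_freeEnergy hn hβ hVt hy, sphereArea, ENNReal.ofReal_mul measureReal_nonneg,
    ofReal_measureReal, ENNReal.ofReal_mul (by positivity)]
  ring

/-- The density of the coarse-grained measure, by integration in polar coordinates. -/
lemma radialMeasure_eq_withDensity (hn : 1 ≤ n) (hβ : 0 < β) (hVt : ∀ x, V x = Vt ‖x‖)
    (hV : Continuous V) :
    radialMeasure β V = (volume.restrict (Ioi 0)).withDensity
      (fun y => ENNReal.ofReal (sphereArea n * Real.exp (-β * freeEnergy hn β V y))) := by
  ext s hs
  have hs' : MeasurableSet ((fun x : EuclideanSpace ℝ (Fin n) => ‖x‖) ⁻¹' s) := measurable_norm hs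
  have hm : Measurable fun x => ENNReal.ofReal (Real.exp (-β * V x)) := by fun_prop
  rw [radialMeasure, Measure.map_apply measurable_norm hs, gibbsMeasure, withDensity_apply _ hs',
    withDensity_apply _ hs, ← lintegral_indicator hs', lintegral_polar hn (hm.indicator hs'),
    ← lintegral_indicator hs]
  refine setLIntegral_congr_fun measurableSet_Ioi fun y hy => ?_
  have hy : 0 < y := hy
  by_cases hys : y ∈ s
  · rw [indicator_of_mem hys, ← lintegral_exp_sphereMeasure hn hβ hVt hV hy,
      lintegral_sphereMeasure hy (hm.indicator hs'), lintegral_sphereMeasure hy hm]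
    congr 1
    refine lintegral_congr fun u => indicator_of_mem ?_ _
    rwa [mem_preimage, norm_smul_sphere hy]
  · rw [indicator_of_notMem hys, lintegral_sphereMeasure hy (hm.indicator hs')]
    refine mul_eq_zero_of_right _ ?_
    rw [← lintegral_zero (μ := unitSphereMeasure n)]
    refine lintegral_congr fun u => indicator_of_notMem ?_ _
    rwa [mem_preimage, norm_smul_sphere hy]

lemma radialMeasure_univ (hV : Integrable (fun x => Real.exp (-β * V x))) :
    radialMeasure β V univ = ENNReal.ofReal (∫ x, Real.exp (-β * V x)) := by
  rw [radialMeasure, Measure.map_apply measurable_norm MeasurableSet.univ, preimage_univ,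
    gibbsMeasure, withDensity_apply _ MeasurableSet.univ, Measure.restrict_univ,
    ofReal_integral_eq_lintegral_ofReal hV (ae_of_all _ fun _ => (Real.exp_pos _).le)]

lemma radialMeasure_univ_ne_zero (hV : Integrable (fun x => Real.exp (-β * V x))) :
    radialMeasure β V univ ≠ 0 := by
  rw [radialMeasure_univ hV]
  exact (ENNReal.ofReal_pos.2 (integral_exp_pos hV)).ne'

lemma isProbabilityMeasure_normalized (hV : Integrable (fun x => Real.exp (-β * V x))) :
    IsProbabilityMeasure ((radialMeasure β V univ)⁻¹ • radialMeasure β V) := by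
  refine ⟨?_⟩
  rw [Measure.smul_apply, smul_eq_mul, ENNReal.inv_mul_cancel (radialMeasure_univ_ne_zero hV)]
  rw [radialMeasure_univ hV]
  exact ENNReal.ofReal_ne_top

lemma normalized_eq_withDensity (hn : 1 ≤ n) (hβ : 0 < β) (hVt : ∀ x, V x = Vt ‖x‖)
    (hV : Continuous V) (hi : Integrable (fun x => Real.exp (-β * V x))) :
    (radialMeasure β V univ)⁻¹ • radialMeasure β V = (volume.restrict (Ioi 0)).withDensity
      (fun y => ENNReal.ofReal ((∫ r in Ioi (0 : ℝ), Real.exp (-β * freeEnergy hn β V r))⁻¹ *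
        Real.exp (-β * freeEnergy hn β V y))) := by
  have hF := measurable_freeEnergy (β := β) hn hV
  have hc := sphereArea_pos hn
  set g : ℝ → ℝ := fun y => Real.exp (-β * freeEnergy hn β V y) with hg
  have hgm : Measurable g := by fun_prop
  have hmass : radialMeasure β V univ =
      ENNReal.ofReal (sphereArea n) * ∫⁻ y in Ioi 0, ENNReal.ofReal (g y) := by
    rw [radialMeasure_eq_withDensity hn hβ hVt hV, withDensity_apply _ MeasurableSet.univ,
      Measure.restrict_univ, ← lintegral_const_mul _ (by fun_prop)]
    simp only [hg, ENNReal.ofReal_mul hc.le]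
  have hint : ∫⁻ y in Ioi 0, ENNReal.ofReal (g y) = ENNReal.ofReal (∫ y in Ioi 0, g y) := by
    refine (ofReal_integral_eq_lintegral_ofReal ⟨hgm.aestronglyMeasurable, ?_⟩
      (ae_of_all _ fun _ => (Real.exp_pos _).le)).symm
    rw [hasFiniteIntegral_iff_ofReal (ae_of_all _ fun _ => (Real.exp_pos _).le), lt_top_iff_ne_top]
    intro htop
    rw [htop, ENNReal.mul_top (ENNReal.ofReal_pos.2 hc).ne', radialMeasure_univ hi] at hmass
    exact ENNReal.ofReal_ne_top hmass
  have hpos : 0 < ∫ y in Ioi 0, g y := by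
    refine ENNReal.ofReal_pos.1 (pos_of_ne_zero fun h0 => ?_)
    rw [hint, h0, mul_zero] at hmass
    exact radialMeasure_univ_ne_zero hi hmass
  rw [hmass, hint, ← ENNReal.ofReal_mul hc.le, ← ENNReal.ofReal_inv_of_pos (by positivity),
    radialMeasure_eq_withDensity hn hβ hVt hV, ← withDensity_smul _ (by fun_prop)]
  congr 1
  ext y
  rw [Pi.smul_apply, smul_eq_mul, ← ENNReal.ofReal_mul (by positivity)]
  congr 1
  simp only [hg]
  field_simp

/-- The density determines the free energy up to an additive constant. -/
lemma freeEnergy_unique (hβ : 0 < β) {F G : ℝ → ℝ} {c c' : ℝ} (hF : Measurable F)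
    (hG : Measurable G) (hc : 0 < c) (hc' : 0 < c')
    (h : (volume.restrict (Ioi (0 : ℝ))).withDensity
        (fun y => ENNReal.ofReal (c' * Real.exp (-β * F y))) =
      (volume.restrict (Ioi (0 : ℝ))).withDensity
        (fun y => ENNReal.ofReal (c * Real.exp (-β * G y)))) :
    ∃ C : ℝ, ∀ᵐ y ∂(volume.restrict (Ioi (0 : ℝ))), G y = F y + C := by
  rw [withDensity_eq_iff_of_sigmaFinite (by fun_prop) (by fun_prop)] at h
  refine ⟨(Real.log c - Real.log c') / β, ?_⟩
  filter_upwards [h] with y hy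
  rw [ENNReal.ofReal_eq_ofReal_iff (by positivity) (by positivity)] at hy
  have h1 := congrArg Real.log hy
  rw [Real.log_mul hc.ne' (Real.exp_ne_zero _), Real.log_mul hc'.ne' (Real.exp_ne_zero _),
    Real.log_exp, Real.log_exp] at h1
  field_simp
  linarith

/-- The function `e^{-βV}`, cut off far away. -/
noncomputable def cutoffGibbs (β : ℝ) (V : EuclideanSpace ℝ (Fin n) → ℝ) (k : ℕ)
    (x : EuclideanSpace ℝ (Fin n)) : ℝ :=
  cutoff k ‖x‖ * Real.exp (-β * V x)

lemma continuous_cutoffGibbs (hV : Continuous V) (k : ℕ) : Continuous (cutoffGibbs β V k) := by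
  have := (cutoff k).continuous
  unfold cutoffGibbs
  fun_prop

lemma hasCompactSupport_cutoffGibbs (k : ℕ) : HasCompactSupport (cutoffGibbs β V k) := by
  refine HasCompactSupport.intro (isCompact_closedBall 0 k) fun x hx => ?_
  simp only [Metric.mem_closedBall, dist_zero_right, not_le] at hx
  rw [cutoffGibbs, cutoff_apply, abs_norm,
    Real.toNNReal_of_nonpos ((min_le_right _ _).trans (by linarith)), NNReal.coe_zero, zero_mul]

/-- Locally finite measures that integrate the functions `cutoffGibbs β V k` alike also integrate
`e^{-βV}` alike. -/
lemma lintegral_exp_eq_of_integral_cutoffGibbs (hV : Continuous V)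
    {m m' : Measure (EuclideanSpace ℝ (Fin n))} [IsLocallyFiniteMeasure m]
    [IsLocallyFiniteMeasure m']
    (h : ∀ k, ∫ x, cutoffGibbs β V k x ∂m = ∫ x, cutoffGibbs β V k x ∂m') :
    ∫⁻ x, ENNReal.ofReal (Real.exp (-β * V x)) ∂m =
      ∫⁻ x, ENNReal.ofReal (Real.exp (-β * V x)) ∂m' := by
  have hnn : ∀ k, 0 ≤ cutoffGibbs β V k := fun k x =>
    mul_nonneg (NNReal.coe_nonneg _) (Real.exp_pos _).le
  have hlim : ∀ p : Measure (EuclideanSpace ℝ (Fin n)), IsLocallyFiniteMeasure p →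
      Tendsto (fun k => ENNReal.ofReal (∫ x, cutoffGibbs β V k x ∂p)) atTop
        (𝓝 (∫⁻ x, ENNReal.ofReal (Real.exp (-β * V x)) ∂p)) := by
    intro p hp
    simp only [fun k => ofReal_integral_eq_lintegral_ofReal
      ((continuous_cutoffGibbs (β := β) hV k).integrable_of_hasCompactSupport (μ := p)
        (hasCompactSupport_cutoffGibbs k)) (ae_of_all _ (hnn k))]
    refine lintegral_tendsto_of_tendsto_of_monotone
      (fun k => (continuous_cutoffGibbs hV k).measurable.ennreal_ofReal.aemeasurable)
      (ae_of_all _ fun x a b hab => ENNReal.ofReal_le_ofReal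
        (mul_le_mul_of_nonneg_right (NNReal.coe_le_coe.2 (monotone_cutoff _ hab))
          (Real.exp_pos _).le)) (ae_of_all _ fun x => ?_)
    simp only [cutoffGibbs, ENNReal.ofReal_mul (NNReal.coe_nonneg _), ENNReal.ofReal_coe_nnreal]
    have := ENNReal.Tendsto.mul_const (b := ENNReal.ofReal (Real.exp (-β * V x)))
      (tendsto_cutoff ‖x‖) (Or.inl one_ne_zero)
    simpa using this
  exact tendsto_nhds_unique (hlim m ‹_›) ((hlim m' ‹_›).congr fun k => by rw [h k])

/-- The microcanonical formula for every measure that agrees with the surface measure on the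
functions `cutoffGibbs β V k`. -/
lemma freeEnergy_eq_log_integral (hn : 1 ≤ n) (hβ : 0 < β) (hVt : ∀ x, V x = Vt ‖x‖)
    (hV : Continuous V) {y : ℝ} (hy : 0 < y) {m : Measure (EuclideanSpace ℝ (Fin n))}
    [IsLocallyFiniteMeasure m]
    (h : ∀ k, ∫ x, cutoffGibbs β V k x ∂m = ∫ x, cutoffGibbs β V k x ∂(sphereMeasure n y)) :
    Integrable (fun x => Real.exp (-β * V x)) m ∧ 0 < ∫ x, Real.exp (-β * V x) ∂m ∧
      -β * freeEnergy hn β V y =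
        Real.log (∫ x, Real.exp (-β * V x) ∂m) + -Real.log (sphereArea n) := by
  have hc := sphereArea_pos hn
  have hnn : 0 ≤ᵐ[m] fun x => Real.exp (-β * V x) := ae_of_all _ fun _ => (Real.exp_pos _).le
  have h1 := lintegral_exp_eq_of_integral_cutoffGibbs hV h
  rw [lintegral_exp_sphereMeasure hn hβ hVt hV hy] at h1
  have hm : AEStronglyMeasurable (fun x => Real.exp (-β * V x)) m :=
    Continuous.aestronglyMeasurable (by fun_prop)
  have hi : Integrable (fun x => Real.exp (-β * V x)) m := by
    refine ⟨hm, ?_⟩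
    rw [hasFiniteIntegral_iff_ofReal hnn, h1]
    exact ENNReal.ofReal_lt_top
  have h2 : ∫ x, Real.exp (-β * V x) ∂m =
      sphereArea n * Real.exp (-β * freeEnergy hn β V y) := by
    rw [integral_eq_lintegral_of_nonneg_ae hnn hm, h1, ENNReal.toReal_ofReal (by positivity)]
  refine ⟨hi, by rw [h2]; positivity, ?_⟩
  rw [h2, Real.log_mul hc.ne' (Real.exp_ne_zero _), Real.log_exp]
  ring

/-- Two microcanonical families integrate a given test function alike at almost every level. -/
lemma IsMicrocanonicalFamily.ae_integral_eq {f : EuclideanSpace ℝ (Fin n) → ℝ}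
    {δ δ' : ℝ → Measure (EuclideanSpace ℝ (Fin n))} (h : IsMicrocanonicalFamily f δ)
    (h' : IsMicrocanonicalFamily f δ') {φ : EuclideanSpace ℝ (Fin n) → ℝ} (hφ : Continuous φ)
    (hφc : HasCompactSupport φ) : ∀ᵐ a, ∫ x, φ x ∂(δ a) = ∫ x, φ x ∂(δ' a) := by
  have h1 := (h.2 φ hφ hφc (fun _ => 1) continuous_const).1
  have h2 := (h'.2 φ hφ hφc (fun _ => 1) continuous_const).1
  simp only [one_mul] at h1 h2
  refine ae_eq_of_integral_contDiff_smul_eq h1.locallyIntegrable h2.locallyIntegrable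
    fun g hg _ => ?_
  simp only [smul_eq_mul]
  rw [(h.2 φ hφ hφc g hg.continuous).2, (h'.2 φ hφ hφc g hg.continuous).2]

lemma ae_rnDeriv_radialMeasure (hn : 1 ≤ n) (hβ : 0 < β) (hVt : ∀ x, V x = Vt ‖x‖)
    (hV : Continuous V) :
    ∀ᵐ y ∂(volume.restrict (Ioi 0)), (radialMeasure β V).rnDeriv volume y =
      ENNReal.ofReal (sphereArea n * Real.exp (-β * freeEnergy hn β V y)) := by
  have hF := measurable_freeEnergy (β := β) hn hV
  rw [radialMeasure_eq_withDensity hn hβ hVt hV, ← withDensity_indicator measurableSet_Ioi,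
    ae_restrict_iff' measurableSet_Ioi]
  filter_upwards [Measure.rnDeriv_withDensity volume (Measurable.indicator (by fun_prop :
    Measurable fun y => ENNReal.ofReal (sphereArea n * Real.exp (-β * freeEnergy hn β V y)))
    (measurableSet_Ioi (a := (0 : ℝ))))] with y hy hy0
  rw [hy, indicator_of_mem hy0]

end FreeEnergy

end Langevin

open Langevin

theorem lemmal (n : ℕ) (hn : 1 ≤ n) :
    -- the constants depend on the dimension only
    ∃ c' k₁ k₂ : ℝ, 0 < c' ∧
    ∀ (β : ℝ), 0 < β → ∀ (Vt : ℝ → ℝ) (V : EuclideanSpace ℝ (Fin n) → ℝ),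
    (∀ x, V x = Vt ‖x‖) → ContDiff ℝ 2 V →
    -- `ν_n` is an invariant measure (possibly of infinite mass) of the process `Y = |X|`
    (LangevinWellPosed.{u} β V →
      ∃ κ : ℝ≥0 → Kernel ℝ ℝ, IsRadialTransition.{u} β V κ ∧
        ∀ t, (κ t).Invariant (radialMeasure β V)) ∧
    -- if it has finite mass, then, normalized, it is a stationary law of `Y`
    (Integrable (fun x => Real.exp (-β * V x)) →
      IsProbabilityMeasure ((radialMeasure β V univ)⁻¹ • radialMeasure β V) ∧
      ∀ (Ω : Type u) [MeasurableSpace Ω] (P : Measure Ω)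
        (W X : ℝ≥0 → Ω → EuclideanSpace ℝ (Fin n)), IsLangevinSolution β V P W X →
        P.map (fun ω => ‖X 0 ω‖) = (radialMeasure β V univ)⁻¹ • radialMeasure β V →
        ∀ t, P.map (fun ω => ‖X t ω‖) = (radialMeasure β V univ)⁻¹ • radialMeasure β V) ∧
    -- the microcanonical measures of `Φ_n(x) = |x|` exist
    (∃ δ : ℝ → Measure (EuclideanSpace ℝ (Fin n)),
      IsMicrocanonicalFamily (fun x => ‖x‖) δ ∧
      ∀ y, 0 < y → IsMicrocanonicalAt (fun x => ‖x‖) y (δ y)) ∧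
    -- the free energy
    ∃ F : ℝ → ℝ,
      -- `ν_n(dy) = c'_n e^{-βF_n(y)} dy` on `(0, ∞)`
      radialMeasure β V = (volume.restrict (Ioi 0)).withDensity
        (fun y => ENNReal.ofReal (c' * Real.exp (-β * F y))) ∧
      -- the same with the normalizing constant, if the mass is finite
      (Integrable (fun x => Real.exp (-β * V x)) →
        (radialMeasure β V univ)⁻¹ • radialMeasure β V = (volume.restrict (Ioi 0)).withDensity
          (fun y => ENNReal.ofReal
            ((∫ r in Ioi (0 : ℝ), Real.exp (-β * F r))⁻¹ * Real.exp (-β * F y)))) ∧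
      -- this determines `F_n` up to an additive constant
      (∀ (G : ℝ → ℝ) (c : ℝ), Measurable G → 0 < c →
        radialMeasure β V = (volume.restrict (Ioi 0)).withDensity
          (fun y => ENNReal.ofReal (c * Real.exp (-β * G y))) →
        ∃ C : ℝ, ∀ᵐ y ∂(volume.restrict (Ioi 0)), G y = F y + C) ∧
      -- logarithm of the Lebesgue density
      (∀ᵐ y ∂(volume.restrict (Ioi 0)),
        0 < (radialMeasure β V).rnDeriv volume y ∧ (radialMeasure β V).rnDeriv volume y < ⊤ ∧
        -β * F y = Real.log ((radialMeasure β V).rnDeriv volume y).toReal + k₁) ∧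
      -- microcanonical formula, at every level `y > 0`
      (∀ y, 0 < y → ∀ m : Measure (EuclideanSpace ℝ (Fin n)),
        IsMicrocanonicalAt (fun x => ‖x‖) y m →
        Integrable (fun x => Real.exp (-β * V x)) m ∧ 0 < ∫ x, Real.exp (-β * V x) ∂m ∧
        -β * F y = Real.log (∫ x, Real.exp (-β * V x) ∂m) + k₂) ∧
      -- microcanonical formula, for every disintegration
      (∀ δ : ℝ → Measure (EuclideanSpace ℝ (Fin n)),
        IsMicrocanonicalFamily (fun x => ‖x‖) δ →
        ∀ᵐ y ∂(volume.restrict (Ioi 0)),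
          Integrable (fun x => Real.exp (-β * V x)) (δ y) ∧
          0 < ∫ x, Real.exp (-β * V x) ∂(δ y) ∧
          -β * F y = Real.log (∫ x, Real.exp (-β * V x) ∂(δ y)) + k₂) ∧
      -- free energy = energy - (1/β) entropy
      (∀ y, 0 < y → F y = Vt y - 1 / β * radialEntropy n y) := by
  have hc := sphereArea_pos hn
  refine ⟨sphereArea n, -Real.log (sphereArea n), -Real.log (sphereArea n), hc, ?_⟩
  intro β hβ Vt V hVt hV
  have hVc := hV.continuous
  have hfam := isMicrocanonicalFamily_sphereMeasure hn
  refine ⟨exists_isRadialTransition hn hβ hVt hV, fun hi => ⟨isProbabilityMeasure_normalized hi,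
    fun Ω _ P W X hs h0 t => map_norm_eq_of_initial hn hβ hVt hV hs h0 t⟩,
    ⟨sphereMeasure n, hfam, fun y hy => isMicrocanonicalAt_sphereMeasure hn hy⟩,
    freeEnergy hn β V, radialMeasure_eq_withDensity hn hβ hVt hVc,
    normalized_eq_withDensity hn hβ hVt hVc, fun G c hG hc0 h => ?_, ?_, fun y hy m hm => ?_,
    fun δ hδ => ?_, fun y hy => freeEnergy_of_pos hn hVt hy⟩
  · rw [radialMeasure_eq_withDensity hn hβ hVt hVc] at h
    exact freeEnergy_unique hβ (measurable_freeEnergy hn hVc) hG hc0 hc h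
  · filter_upwards [ae_rnDeriv_radialMeasure hn hβ hVt hVc] with y hy
    rw [hy]
    refine ⟨ENNReal.ofReal_pos.2 (by positivity), ENNReal.ofReal_lt_top, ?_⟩
    rw [ENNReal.toReal_ofReal (by positivity), Real.log_mul hc.ne' (Real.exp_ne_zero _),
      Real.log_exp]
    ring
  · have := hm.1
    exact freeEnergy_eq_log_integral hn hβ hVt hVc hy fun k => tendsto_nhds_unique
      (hm.2 _ (continuous_cutoffGibbs hVc k) (hasCompactSupport_cutoffGibbs k))
      ((isMicrocanonicalAt_sphereMeasure hn hy).2 _ (continuous_cutoffGibbs hVc k)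
        (hasCompactSupport_cutoffGibbs k))
  · have hk : ∀ᵐ y, ∀ k, ∫ x, cutoffGibbs β V k x ∂(δ y) =
        ∫ x, cutoffGibbs β V k x ∂(sphereMeasure n y) := ae_all_iff.2 fun k =>
      IsMicrocanonicalFamily.ae_integral_eq hδ hfam (continuous_cutoffGibbs hVc k)
        (hasCompactSupport_cutoffGibbs k)
    rw [ae_restrict_iff' measurableSet_Ioi]
    filter_upwards [hδ.1, hk] with y hloc hy hy0
    exact freeEnergy_eq_log_integral hn hβ hVt hVc hy0 hy
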